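/- **Lemma.** Let $(k,D_k)$ be a differential field of characteristic zero: $k$ is a field with $\operatorname{char} k=0$, $D_k$ is a finite-dimensional $k$-vector space with a Lie ring structure $[\cdot,\cdot]$, and $\theta\colon D_k\to \mathrm{Der}(k,k)$ is a morphism of both $k$-vector spaces and Lie rings such that $[\partial_1,a\partial_2]-a[\partial_1,\partial_2]=\partial_1(a)\,\partial_2$ for all $a\in k$ and $\partial_1,\partial_2\in D_k$, where $\partial(a):=\theta(\partial)(a)$. (The map $\theta$ is not assumed to be injective, and $D_k$ is not assumed to have a commuting basis.) A $D_k$-algebra is a commutative $k$-algebra $S$ together with a $k$-linear morphism of Lie rings $D_k\to\mathrm{Der}(S,S)$ such that each $\partial\in D_k$ acts on the image of $k$ through $\theta(\partial)$; a morphism of $D_k$-algebras is a homomorphism of $k$-algebras commuting with $D_k$. On $S\otimes_k T$ the action is $\partial(s\otimes t)=\partial s\otimes t+s\otimes\partial t$. A $D_k$-algebra $S$ is $D_k$-finitely generated if there is a finite subset $\Sigma\subset S$ such that every element of $S$ is a polynomial with coefficients in $k$ in elements of the form $\partial_1\cdots\partial_m a$ with $m\geq 0$, $\partial_i\in D_k$,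 $a\in\Sigma$. A $D_k$-Hopf algebra is a commutative Hopf algebra over $k$ that is a $D_k$-algebra and whose coproduct, counit and antipode are morphisms of $D_k$-algebras. Then every $D_k$-finitely generated $D_k$-Hopf algebra $B$ over $k$ is of $D_k$-finite presentation over $k$: there exist $n\ge 0$, an ideal $I$ of the ring of $D_k$-polynomials $k\{T_1,\dots,T_n\}$ (the free $D_k$-algebra on $T_1,\dots,T_n$) and an isomorphism of $D_k$-algebras $$B\cong k\{T_1,\dots,T_n\}/I,$$ where $I$ is $D_k$-finitely generated, that is, $I$ is the smallest $D_k$-stable ideal containing some finite subset of $k\{T_1,\dots,T_n\}$. -/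

import Mathlib

open scoped TensorProduct

/-!
Conventions. A differential ring `(k, D)` is a commutative ring `k` and a Lie ring `D` with
`[Module k D] [LieRingModule D k] [LieRinehartRing k D]`, the module `D` being finitely generated
and projective; the anchor `D → Der(k, k)` sends `x` to `a ↦ ⁅x, a⁆`. It need not be injective and
`D` need not have a commuting basis. An iterated derivative `x₁ (x₂ (⋯ (xₘ a)))` is written
`[x₁, …, xₘ].foldr (fun x b ↦ ⁅x, b⁆) a`.
-/

/-- A `D`-algebra over the differential ring `(k, D)`: a commutative `k`-algebra `S` on which the
Lie ring `D` acts (by additive maps, brackets acting as commutators) by derivations which extend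
the given derivations of `k`, the action being `k`-linear in `D`. -/
class DiffAlgebra (k D S : Type*) [CommRing k] [LieRing D] [Module k D] [LieRingModule D k]
    [CommRing S] [Algebra k S] [LieRingModule D S] : Prop where
  lie_algebraMap : ∀ (x : D) (a : k), ⁅x, algebraMap k S a⁆ = algebraMap k S ⁅x, a⁆
  smul_lie : ∀ (a : k) (x : D) (s : S), ⁅a • x, s⁆ = a • ⁅x, s⁆
  lie_mul : ∀ (x : D) (s t : S), ⁅x, s * t⁆ = s * ⁅x, t⁆ + t * ⁅x, s⁆

namespace DiffAlgebra

section Basic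

variable (k D S : Type*) [CommRing k] [LieRing D] [Module k D] [LieRingModule D k]
  [CommRing S] [Algebra k S] [LieRingModule D S]

/-- The differential ring `k` itself, as a `D`-algebra. -/
instance self [LieRinehartRing k D] : DiffAlgebra k D k where
  lie_algebraMap _ _ := rfl
  smul_lie a x s := LieRinehartRing.lie_smul_eq_mul a s x
  lie_mul x s t := by
    rw [LieRinehartRing.leibniz_mul_right, smul_eq_mul, mul_comm t]

variable {k D S}

theorem lie_smul [DiffAlgebra k D S] (x : D) (a : k) (s : S) :
    ⁅x, a • s⁆ = a • ⁅x, s⁆ + ⁅x, a⁆ • s := by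
  rw [Algebra.smul_def, lie_mul k, lie_algebraMap, Algebra.smul_def, Algebra.smul_def,
    mul_comm s]

end Basic

section Hom

variable {k S T : Type*} (D : Type*) [CommRing k] [LieRing D]
  [CommRing S] [Algebra k S] [LieRingModule D S]
  [CommRing T] [Algebra k T] [LieRingModule D T]

/-- A homomorphism of `k`-algebras is a morphism of `D`-algebras if it commutes with `D`. -/
def IsDiffHom (f : S →ₐ[k] T) : Prop :=
  ∀ (x : D) (s : S), f ⁅x, s⁆ = ⁅x, f s⁆

end Hom

section Tensor

variable (k D S T : Type*) [CommRing k] [LieRing D] [Module k D] [LieRingModule D k]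
  [CommRing S] [Algebra k S] [LieRingModule D S] [DiffAlgebra k D S]
  [CommRing T] [Algebra k T] [LieRingModule D T] [DiffAlgebra k D T]

/-- The action of `x : D` on `S ⊗ T`, given by `x (s ⊗ t) = x s ⊗ t + s ⊗ x t`. -/
noncomputable def tensorLie (x : D) : S ⊗[k] T →+ S ⊗[k] T :=
  TensorProduct.liftAddHom
    { toFun := fun s ↦
        { toFun := fun t ↦ ⁅x, s⁆ ⊗ₜ[k] t + s ⊗ₜ[k] ⁅x, t⁆
          map_zero' := by simp
          map_add' := fun t t' ↦ by
            simp only [lie_add, TensorProduct.tmul_add]; abel }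
      map_zero' := by ext; simp
      map_add' := fun s s' ↦ by
        ext t
        simp only [lie_add, TensorProduct.add_tmul, AddMonoidHom.coe_mk, ZeroHom.coe_mk,
          AddMonoidHom.add_apply]
        abel }
    (fun a s t ↦ by
      simp only [AddMonoidHom.coe_mk, ZeroHom.coe_mk, lie_smul, TensorProduct.add_tmul,
        TensorProduct.tmul_add, TensorProduct.smul_tmul]
      abel)

noncomputable instance tensorLieRingModule : LieRingModule D (S ⊗[k] T) where
  bracket x z := tensorLie k D S T x z
  add_lie x y z := by
    change tensorLie k D S T (x + y) z = tensorLie k D S T x z + tensorLie k D S T y z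
    induction z with
    | zero => simp
    | tmul s t =>
      simp only [tensorLie, TensorProduct.liftAddHom_tmul, AddMonoidHom.coe_mk, ZeroHom.coe_mk,
        add_lie, TensorProduct.tmul_add, TensorProduct.add_tmul]
      abel
    | add z w hz hw => rw [map_add, map_add, map_add, hz, hw]; abel
  lie_add x z w := (tensorLie k D S T x).map_add z w
  leibniz_lie x y z := by
    change tensorLie k D S T x (tensorLie k D S T y z) =
      tensorLie k D S T ⁅x, y⁆ z + tensorLie k D S T y (tensorLie k D S T x z)
    induction z with
    | zero => simp
    | tmul s t =>
      simp only [tensorLie, TensorProduct.liftAddHom_tmul, AddMonoidHom.coe_mk, ZeroHom.coe_mk,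
        map_add, lie_lie, TensorProduct.sub_tmul, TensorProduct.tmul_sub]
      abel
    | add z w hz hw => simp only [map_add, hz, hw]; abel

variable {k D S T}

theorem lie_tmul (x : D) (s : S) (t : T) :
    ⁅x, s ⊗ₜ[k] t⁆ = ⁅x, s⁆ ⊗ₜ[k] t + s ⊗ₜ[k] ⁅x, t⁆ := rfl

/-- The tensor product of two `D`-algebras is a `D`-algebra. -/
instance tensor : DiffAlgebra k D (S ⊗[k] T) where
  lie_algebraMap x a := by
    have h1 : ⁅x, (1 : T)⁆ = 0 := by
      have := lie_mul k x (1 : T) 1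
      simpa using this
    rw [Algebra.TensorProduct.algebraMap_apply, Algebra.TensorProduct.algebraMap_apply, lie_tmul,
      lie_algebraMap, h1, TensorProduct.tmul_zero, add_zero]
  smul_lie a x z := by
    induction z with
    | zero => simp
    | tmul s t =>
      simp only [lie_tmul, smul_lie, smul_add, TensorProduct.tmul_smul, TensorProduct.smul_tmul']
    | add z w hz hw => simp only [lie_add, hz, hw, smul_add]
  lie_mul x z w := by
    induction z with
    | zero => simp
    | add z z' hz hz' => simp only [add_mul, mul_add, lie_add, hz, hz']; abel
    | tmul s t =>
      induction w with
      | zero => simp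
      | add w w' hw hw' => simp only [add_mul, mul_add, lie_add, hw, hw']; abel
      | tmul s' t' =>
        simp only [lie_tmul, Algebra.TensorProduct.tmul_mul_tmul, lie_mul k,
          TensorProduct.add_tmul, TensorProduct.tmul_add, mul_add]
        rw [mul_comm s' s, mul_comm t' t]
        abel

end Tensor

end DiffAlgebra

/-- A `D`-Hopf algebra over `(k, D)`: a commutative Hopf algebra over `k` which is a `D`-algebra
and whose coproduct, counit and antipode are morphisms of `D`-algebras. -/
class DiffHopfAlgebra (k D B : Type*) [CommRing k] [LieRing D] [Module k D] [LieRingModule D k]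
    [CommRing B] [HopfAlgebra k B] [LieRingModule D B] : Prop extends DiffAlgebra k D B where
  isDiffHom_comul : DiffAlgebra.IsDiffHom D (Bialgebra.comulAlgHom k B)
  isDiffHom_counit : DiffAlgebra.IsDiffHom D (Bialgebra.counitAlgHom k B)
  isDiffHom_antipode : DiffAlgebra.IsDiffHom D (HopfAlgebra.antipodeAlgHom k B)

/-- A `D`-algebra `S` is `D`-finitely generated if there is a finite set `A` in `S` such that each
element of `S` is a polynomial over `k` in iterated derivatives of elements of `A`. -/
def DiffFinitelyGenerated (k D S : Type*) [CommRing k] [LieRing D] [CommRing S] [Algebra k S]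
    [LieRingModule D S] : Prop :=
  ∃ A : Finset S, Algebra.adjoin k
    {s : S | ∃ a ∈ A, ∃ l : List D, s = l.foldr (fun x b ↦ ⁅x, b⁆) a} = ⊤

/-- A `D`-ideal of `S`: an ideal stable under `D`. -/
structure DiffIdeal (D S : Type*) [LieRing D] [CommRing S] [LieRingModule D S] where
  toIdeal : Ideal S
  lie_mem : ∀ (x : D) (s : S), s ∈ toIdeal → ⁅x, s⁆ ∈ toIdeal

namespace DiffIdeal

variable {D S : Type*} [LieRing D] [CommRing S] [LieRingModule D S]

variable (D) in
/-- The `D`-ideal generated by a set: the intersection of all `D`-ideals containing it. -/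
def span (A : Set S) : DiffIdeal D S where
  toIdeal := sInf {I | A ⊆ I ∧ ∀ (x : D) (s : S), s ∈ I → ⁅x, s⁆ ∈ I}
  lie_mem x s hs := by
    rw [Submodule.mem_sInf] at hs ⊢
    exact fun I hI ↦ hI.2 x s (hs I hI)

/-- A `D`-ideal is `D`-finitely generated if it is generated, as a `D`-ideal, by a finite set. -/
def FG (I : DiffIdeal D S) : Prop :=
  ∃ A : Finset S, I = span D (A : Set S)

/-- The action of `D` on the quotient by a `D`-ideal. -/
instance quotientLieRingModule (I : DiffIdeal D S) : LieRingModule D (S ⧸ I.toIdeal) where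
  bracket x := QuotientAddGroup.map I.toIdeal.toAddSubgroup I.toIdeal.toAddSubgroup
    (AddMonoidHom.mk' (fun s : S ↦ ⁅x, s⁆) (fun s t ↦ lie_add x s t)) (fun s hs ↦ I.lie_mem x s hs)
  add_lie x y z := by
    obtain ⟨s, rfl⟩ := Ideal.Quotient.mk_surjective z
    exact congrArg (Ideal.Quotient.mk I.toIdeal) (add_lie x y s)
  lie_add x z w := map_add _ z w
  leibniz_lie x y z := by
    obtain ⟨s, rfl⟩ := Ideal.Quotient.mk_surjective z
    exact congrArg (Ideal.Quotient.mk I.toIdeal) (leibniz_lie x y s)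

theorem lie_mk (I : DiffIdeal D S) (x : D) (s : S) :
    ⁅x, Ideal.Quotient.mk I.toIdeal s⁆ = Ideal.Quotient.mk I.toIdeal ⁅x, s⁆ := rfl

/-- The quotient of a `D`-algebra by a `D`-ideal is a `D`-algebra. -/
instance quotientDiffAlgebra {k : Type*} [CommRing k] [Module k D] [LieRingModule D k]
    [Algebra k S] [DiffAlgebra k D S] (I : DiffIdeal D S) :
    DiffAlgebra k D (S ⧸ I.toIdeal) where
  lie_algebraMap x a :=
    congrArg (Ideal.Quotient.mk I.toIdeal) (DiffAlgebra.lie_algebraMap (S := S) x a)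
  smul_lie a x z := by
    obtain ⟨s, rfl⟩ := Ideal.Quotient.mk_surjective z
    exact congrArg (Ideal.Quotient.mk I.toIdeal) (DiffAlgebra.smul_lie a x s)
  lie_mul x z w := by
    obtain ⟨s, rfl⟩ := Ideal.Quotient.mk_surjective z
    obtain ⟨t, rfl⟩ := Ideal.Quotient.mk_surjective w
    exact congrArg (Ideal.Quotient.mk I.toIdeal) (DiffAlgebra.lie_mul k x s t)

end DiffIdeal

/-! The ring of `D`-polynomials `k{T_i : i ∈ ι}`, that is, the free `D`-algebra on `ι`. -/

namespace DiffPoly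

section Pre

variable (k D ι : Type*) [CommRing k] [LieRing D] [Module k D] [LieRingModule D k]
  [LieRinehartRing k D]

/-- Polynomials in the formal symbols `x₁ ⋯ xₘ T_i`, one for each list `[x₁, …, xₘ]` in `D` and
each `i`. -/
abbrev Pre (k D ι : Type*) [CommRing k] := MvPolynomial (List D × ι) k

variable {k D ι}

/-- The ring homomorphism `p ↦ p + ε x(p)` to the dual numbers that encodes the derivation `x` of
`Pre k D ι` which extends `x` on `k` and sends the symbol `x₁ ⋯ xₘ T_i` to `x x₁ ⋯ xₘ T_i`. -/
noncomputable def preHom (x : D) :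
    Pre k D ι →+* TrivSqZeroExt (Pre k D ι) (Pre k D ι) :=
  MvPolynomial.eval₂Hom
    { toFun := fun a ↦
        TrivSqZeroExt.inl (MvPolynomial.C a) + TrivSqZeroExt.inr (MvPolynomial.C ⁅x, a⁆)
      map_zero' := by simp
      map_one' := by
        have h1 : ⁅x, (1 : k)⁆ = 0 := by
          have := LieRinehartRing.leibniz_mul_right x (1 : k) 1
          simpa using this
        simp [h1]
      map_add' := fun a b ↦ by ext1 <;> simp
      map_mul' := fun a b ↦ by ext1 <;> simp [mul_comm] }
    (fun v ↦ TrivSqZeroExt.inl (MvPolynomial.X v) +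
      TrivSqZeroExt.inr (MvPolynomial.X (x :: v.1, v.2)))

/-- The derivation `x` of `Pre k D ι`. -/
noncomputable def preLie (x : D) (p : Pre k D ι) : Pre k D ι :=
  (preHom x p).snd

theorem preLie_C (x : D) (a : k) :
    preLie x (MvPolynomial.C a : Pre k D ι) = MvPolynomial.C ⁅x, a⁆ := by
  simp [preLie, preHom]

theorem preLie_X (x : D) (l : List D) (i : ι) :
    preLie x (MvPolynomial.X (l, i) : Pre k D ι) = MvPolynomial.X (x :: l, i) := by
  simp [preLie, preHom]

theorem preLie_add (x : D) (p q : Pre k D ι) :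
    preLie x (p + q) = preLie x p + preLie x q := by
  simp [preLie]

theorem preHom_fst (x : D) (p : Pre k D ι) : (preHom x p).fst = p := by
  induction p using MvPolynomial.induction_on with
  | C a => simp [preHom]
  | add p q hp hq => simp [hp, hq]
  | mul_X p v hp => rw [map_mul, TrivSqZeroExt.fst_mul, hp]; simp [preHom]

theorem preLie_mul (x : D) (p q : Pre k D ι) :
    preLie x (p * q) = p * preLie x q + q * preLie x p := by
  simp [preLie, preHom_fst, mul_comm q]

theorem preLie_sub (x : D) (p q : Pre k D ι) :
    preLie x (p - q) = preLie x p - preLie x q := by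
  simp [preLie]

variable (k D ι) in
/-- The relations between the symbols `x₁ ⋯ xₘ T_i` in a `D`-algebra, and their derivatives. -/
inductive Rel : Pre k D ι → Pre k D ι → Prop
  | add (x y : D) (l : List D) (i : ι) : Rel (MvPolynomial.X ((x + y) :: l, i))
      (MvPolynomial.X (x :: l, i) + MvPolynomial.X (y :: l, i))
  | smul (a : k) (x : D) (l : List D) (i : ι) : Rel (MvPolynomial.X ((a • x) :: l, i))
      (MvPolynomial.C a * MvPolynomial.X (x :: l, i))
  | lie (x y : D) (l : List D) (i : ι) : Rel (MvPolynomial.X (⁅x, y⁆ :: l, i))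
      (MvPolynomial.X (x :: y :: l, i) - MvPolynomial.X (y :: x :: l, i))
  | deriv (z : D) (p q : Pre k D ι) : Rel p q → Rel (preLie z p) (preLie z q)

variable (k D ι) in
/-- The ideal of `Pre k D ι` generated by the relations. -/
noncomputable def relIdeal : Ideal (Pre k D ι) :=
  Ideal.span {r | ∃ p q, Rel k D ι p q ∧ r = p - q}

theorem Rel.mk_eq {p q : Pre k D ι} (h : Rel k D ι p q) :
    Ideal.Quotient.mk (relIdeal k D ι) p = Ideal.Quotient.mk (relIdeal k D ι) q :=
  Ideal.Quotient.eq.2 (Ideal.subset_span ⟨p, q, h, rfl⟩)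

theorem preLie_mem (x : D) (p : Pre k D ι) (hp : p ∈ relIdeal k D ι) :
    preLie x p ∈ relIdeal k D ι := by
  induction hp using Submodule.span_induction with
  | mem r hr =>
    obtain ⟨p, q, h, rfl⟩ := hr
    rw [preLie_sub]
    exact Ideal.subset_span ⟨_, _, h.deriv x p q, rfl⟩
  | zero => simp [preLie]
  | add p q _ _ hp hq => rw [preLie_add]; exact add_mem hp hq
  | smul a p h hp =>
    rw [smul_eq_mul, preLie_mul]
    exact add_mem (Ideal.mul_mem_left _ _ hp) (Ideal.mul_mem_right _ _ h)

end Pre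

end DiffPoly

/-- The ring `k{T_i : i ∈ ι}` of `D`-polynomials over the differential ring `(k, D)`. -/
def DiffPoly (k D ι : Type*) [CommRing k] [LieRing D] [Module k D] [LieRingModule D k]
    [LieRinehartRing k D] : Type _ :=
  DiffPoly.Pre k D ι ⧸ DiffPoly.relIdeal k D ι

namespace DiffPoly

variable {k D ι : Type*} [CommRing k] [LieRing D] [Module k D] [LieRingModule D k]
  [LieRinehartRing k D]

noncomputable instance : CommRing (DiffPoly k D ι) :=
  inferInstanceAs (CommRing (Pre k D ι ⧸ relIdeal k D ι))

noncomputable instance : Algebra k (DiffPoly k D ι) :=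
  inferInstanceAs (Algebra k (Pre k D ι ⧸ relIdeal k D ι))

variable (k D ι) in
/-- The quotient map from `Pre k D ι`. -/
noncomputable def mk : Pre k D ι →ₐ[k] DiffPoly k D ι :=
  Ideal.Quotient.mkₐ k (relIdeal k D ι)

theorem mk_surjective : Function.Surjective (mk k D ι) :=
  Ideal.Quotient.mk_surjective

/-- The action of `x : D` on `k{T_i}`, induced by `preLie x`. -/
noncomputable def lieHom (x : D) : DiffPoly k D ι →+ DiffPoly k D ι :=
  QuotientAddGroup.map (relIdeal k D ι).toAddSubgroup (relIdeal k D ι).toAddSubgroup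
    (AddMonoidHom.mk' (preLie x) (preLie_add x)) (fun p hp ↦ preLie_mem x p hp)

theorem lieHom_mk (x : D) (p : Pre k D ι) : lieHom x (mk k D ι p) = mk k D ι (preLie x p) := rfl

theorem lieHom_mul (x : D) (f g : DiffPoly k D ι) :
    lieHom x (f * g) = f * lieHom x g + g * lieHom x f := by
  obtain ⟨p, rfl⟩ := mk_surjective f
  obtain ⟨q, rfl⟩ := mk_surjective g
  simp only [← map_mul, lieHom_mk, preLie_mul, map_add]

theorem lieHom_C (x : D) (a : k) :
    lieHom x (mk k D ι (MvPolynomial.C a)) = mk k D ι (MvPolynomial.C ⁅x, a⁆) := by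
  rw [lieHom_mk, preLie_C]

theorem lieHom_X (x : D) (l : List D) (i : ι) :
    lieHom x (mk k D ι (MvPolynomial.X (l, i))) = mk k D ι (MvPolynomial.X (x :: l, i)) := by
  rw [lieHom_mk, preLie_X]

theorem lieHom_add (x y : D) (f : DiffPoly k D ι) :
    lieHom (x + y) f = lieHom x f + lieHom y f := by
  obtain ⟨p, rfl⟩ := mk_surjective f
  induction p using MvPolynomial.induction_on with
  | C a => simp only [lieHom_C, add_lie, map_add]
  | add p q hp hq => simp only [map_add, hp, hq]; abel
  | mul_X p v hp =>
    have h : mk k D ι (MvPolynomial.X ((x + y) :: v.1, v.2)) =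
        mk k D ι (MvPolynomial.X (x :: v.1, v.2)) + mk k D ι (MvPolynomial.X (y :: v.1, v.2)) :=
      (Rel.add x y v.1 v.2).mk_eq
    rw [map_mul, lieHom_mul, lieHom_mul, lieHom_mul, hp, lieHom_X, lieHom_X, lieHom_X, h]
    ring

theorem lieHom_smul (a : k) (x : D) (f : DiffPoly k D ι) :
    lieHom (a • x) f = a • lieHom x f := by
  obtain ⟨p, rfl⟩ := mk_surjective f
  induction p using MvPolynomial.induction_on with
  | C b => rw [lieHom_C, lieHom_C, LieRinehartRing.lie_smul_eq_mul, map_mul, map_mul,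
      Algebra.smul_def]; rfl
  | add p q hp hq => simp only [map_add, hp, hq, smul_add]
  | mul_X p v hp =>
    have h : mk k D ι (MvPolynomial.X ((a • x) :: v.1, v.2)) =
        a • mk k D ι (MvPolynomial.X (x :: v.1, v.2)) := by
      rw [← map_smul, MvPolynomial.smul_eq_C_mul]
      exact (Rel.smul a x v.1 v.2).mk_eq
    rw [map_mul, lieHom_mul, lieHom_mul, hp, lieHom_X, lieHom_X, h, smul_add, mul_smul_comm,
      mul_smul_comm]

theorem lieHom_lie (x y : D) (f : DiffPoly k D ι) :
    lieHom x (lieHom y f) = lieHom ⁅x, y⁆ f + lieHom y (lieHom x f) := by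
  obtain ⟨p, rfl⟩ := mk_surjective f
  induction p using MvPolynomial.induction_on with
  | C a => simp only [lieHom_C, lie_lie, map_sub]; abel
  | add p q hp hq => simp only [map_add, hp, hq]; abel
  | mul_X p v hp =>
    have h : mk k D ι (MvPolynomial.X (⁅x, y⁆ :: v.1, v.2)) =
        mk k D ι (MvPolynomial.X (x :: y :: v.1, v.2)) -
          mk k D ι (MvPolynomial.X (y :: x :: v.1, v.2)) := by
      rw [← map_sub]
      exact (Rel.lie x y v.1 v.2).mk_eq
    obtain ⟨l, i⟩ := v
    simp only [map_mul, map_add, lieHom_mul, hp, lieHom_X, h]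
    ring

noncomputable instance : LieRingModule D (DiffPoly k D ι) where
  bracket x f := lieHom x f
  add_lie := lieHom_add
  lie_add x := (lieHom x).map_add
  leibniz_lie := lieHom_lie

instance : DiffAlgebra k D (DiffPoly k D ι) where
  lie_algebraMap := lieHom_C
  smul_lie := lieHom_smul
  lie_mul := lieHom_mul

variable (k D) in
/-- The differential indeterminate `T_i`. -/
noncomputable def T (i : ι) : DiffPoly k D ι := mk k D ι (MvPolynomial.X ([], i))

theorem mk_X (l : List D) (i : ι) :
    mk k D ι (MvPolynomial.X (l, i)) = l.foldr (fun x b ↦ ⁅x, b⁆) (T k D i) := by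
  induction l with
  | nil => rfl
  | cons x l ih => rw [List.foldr_cons, ← ih]; exact (lieHom_X x l i).symm

/-- `k{T_i}` is freely generated by the `T_i` as a `D`-algebra. -/
theorem existsUnique_lift {S : Type*} [CommRing S] [Algebra k S] [LieRingModule D S]
    [DiffAlgebra k D S] (s : ι → S) :
    ∃! f : DiffPoly k D ι →ₐ[k] S, DiffAlgebra.IsDiffHom D f ∧ ∀ i, f (T k D i) = s i := by
  let g : Pre k D ι →ₐ[k] S :=
    MvPolynomial.aeval fun v ↦ v.1.foldr (fun x b ↦ ⁅x, b⁆) (s v.2)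
  have hX (v : List D × ι) : g (MvPolynomial.X v) = v.1.foldr (fun x b ↦ ⁅x, b⁆) (s v.2) :=
    MvPolynomial.aeval_X _ v
  have hC (a : k) : g (MvPolynomial.C a) = algebraMap k S a := MvPolynomial.aeval_C _ a
  have hg (x : D) (p : Pre k D ι) : g (preLie x p) = ⁅x, g p⁆ := by
    induction p using MvPolynomial.induction_on with
    | C a => rw [preLie_C, hC, hC, DiffAlgebra.lie_algebraMap]
    | add p q hp hq => rw [preLie_add, map_add, map_add, hp, hq, lie_add]
    | mul_X p v hp =>
      rw [preLie_mul, map_add, map_mul, map_mul, map_mul, hp, preLie_X, hX, hX,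
        DiffAlgebra.lie_mul k, List.foldr_cons]
  have hrel (p q : Pre k D ι) (h : Rel k D ι p q) : g p = g q := by
    induction h with
    | add x y l i => simp only [map_add, hX, List.foldr_cons, add_lie]
    | smul a x l i =>
      simp only [map_mul, hX, hC, List.foldr_cons, DiffAlgebra.smul_lie, Algebra.smul_def]
    | lie x y l i => simp only [map_sub, hX, List.foldr_cons, lie_lie]
    | deriv z p q _ ih => rw [hg, hg, ih]
  have hker (p : Pre k D ι) (hp : p ∈ relIdeal k D ι) : g p = 0 := by
    have hle : relIdeal k D ι ≤ RingHom.ker g := by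
      refine Ideal.span_le.2 ?_
      rintro _ ⟨p, q, h, rfl⟩
      exact (RingHom.mem_ker).2 (by rw [map_sub, hrel p q h, sub_self])
    exact hle hp
  refine ⟨Ideal.Quotient.liftₐ (relIdeal k D ι) g hker, ⟨fun x f ↦ ?_, fun i ↦ ?_⟩, ?_⟩
  · obtain ⟨p, rfl⟩ := mk_surjective f
    exact hg x p
  · exact hX ([], i)
  · rintro f ⟨hf, hfs⟩
    have hcomp : f.comp (mk k D ι) = g := by
      refine MvPolynomial.algHom_ext fun v ↦ ?_
      obtain ⟨l, i⟩ := v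
      rw [AlgHom.comp_apply, mk_X, hX]
      induction l with
      | nil => exact hfs i
      | cons x l ih => rw [List.foldr_cons, hf, ih, List.foldr_cons]
    refine AlgHom.ext fun z ↦ ?_
    obtain ⟨p, rfl⟩ := mk_surjective z
    exact DFunLike.congr_fun hcomp p

end DiffPoly

/-- A `D`-algebra `S` over `(k, D)` is of `D`-finite presentation if it is isomorphic, as a
`D`-algebra, to `k{T₁, …, Tₙ} / I` with `I` a `D`-finitely generated `D`-ideal. -/
def DiffFinitePresentation (k D S : Type*) [CommRing k] [LieRing D] [Module k D]
    [LieRingModule D k] [LieRinehartRing k D] [CommRing S] [Algebra k S] [LieRingModule D S] :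
    Prop :=
  ∃ (n : ℕ) (I : DiffIdeal D (DiffPoly k D (Fin n))), I.FG ∧
    ∃ e : (DiffPoly k D (Fin n) ⧸ I.toIdeal) ≃ₐ[k] S,
      DiffAlgebra.IsDiffHom D (e : (DiffPoly k D (Fin n) ⧸ I.toIdeal) →ₐ[k] S)

/-! A finite set of generators of `B` lies in the span of the entries of a matrix `X` with `Δ X_ij =
∑ X_il ⊗ X_lj` whose set of entries is stable under the antipode `S`. These entries generate `B` as
a `D`-algebra, so `B` is a quotient `π : k{T_ij} → B`. The task is to bound the order of the
generators of `ker π`.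

Filter by order: let `R_n` be the subalgebra of `B` generated by the derivatives of the `X_ij` of
order less than `n`. Since `Δ` and `S` commute with `D`, each `R_n` is a Hopf subalgebra. For a
differential operator `p` of order `n`, the entries of the logarithmic derivative `p(X) X⁻¹ = p(X)
S(X)` are primitive modulo `R_n`: if `v` is such an entry, then `Δ v - v ⊗ 1` lies in `R_n ⊗ B`. In
characteristic zero, elements of this kind that are linearly independent over `k` modulo `R_n` are
algebraically independent over `R_n` (`algebraicIndependent_of_linearIndependent`). So, up to
relations of lower order, every relation of order `n` comes from `k`-linear relations modulo `R_n`
among logarithmic derivatives of order `n`.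

The symbols of these linear relations are tuples of homogeneous polynomials of degree `n` in `d =
dim D` variables. Applying a basis element of `D` to a relation multiplies its symbol by a variable,
so the symbols form a graded submodule of a free module of finite rank over a polynomial ring. By
the Hilbert basis theorem it is generated in bounded degree (`exists_forall_mem_span_X_smul`). Hence
beyond some order all relations follow from derivatives of earlier ones (`mem_of_mem_ordLT_succ`).
The elements of `k{T_ij}` of bounded order form a finitely generated, hence Noetherian, algebra, so
finitely many relations suffice (`DiffIdeal.fg_of_forall_ordLT`).

No commuting basis of `D` is needed: reordering derivations costs only terms of lower order, and
only the fact that ordered monomials span is used, never their independence. -/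

namespace MvPolynomial

/-- The polynomials of degree less than `n`. -/
noncomputable def degreeLT (τ R : Type*) [CommRing R] (n : ℕ) : Submodule R (MvPolynomial τ R) :=
  restrictSupport R {m | m.degree < n}

/-! ### Polynomials filtered by total degree -/

section DegreeLT

variable {τ R : Type*} [CommRing R]

theorem mem_degreeLT {n : ℕ} {p : MvPolynomial τ R} :
    p ∈ degreeLT τ R n ↔ ∀ m, n ≤ m.degree → coeff m p = 0 := by
  simp only [degreeLT, mem_restrictSupport_iff, Set.subset_def, Finset.mem_coe, mem_support_iff,
    Set.mem_ofPred_eq]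
  exact forall_congr' fun m ↦ by rw [← not_lt, not_imp_comm]

theorem degreeLT_mono {m n : ℕ} (h : m ≤ n) : degreeLT τ R m ≤ degreeLT τ R n := fun _ hp ↦
  mem_degreeLT.2 fun a ha ↦ mem_degreeLT.1 hp a (h.trans ha)

theorem exists_mem_degreeLT (p : MvPolynomial τ R) : ∃ n, p ∈ degreeLT τ R n := by
  refine ⟨p.totalDegree + 1, mem_degreeLT.2 fun m hm ↦ ?_⟩
  refine coeff_eq_zero_of_totalDegree_lt ?_
  rw [← Finsupp.degree_apply]
  omega

theorem mul_X_mem_degreeLT {n : ℕ} {p : MvPolynomial τ R} (hp : p ∈ degreeLT τ R n) (j : τ) :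
    p * X j ∈ degreeLT τ R (n + 1) := by
  classical
  refine mem_degreeLT.2 fun m hm ↦ ?_
  rw [coeff_mul_X']
  split_ifs with h
  · refine mem_degreeLT.1 hp _ ?_
    have h1 : m - Finsupp.single j 1 + Finsupp.single j 1 = m :=
      tsub_add_cancel_of_le (Finsupp.single_le_iff.2
        (Nat.one_le_iff_ne_zero.2 (Finsupp.mem_support_iff.1 h)))
    rw [← h1, map_add, Finsupp.degree_single] at hm
    omega
  · rfl

theorem C_mem_degreeLT {n : ℕ} (hn : 0 < n) (r : R) : C r ∈ degreeLT τ R n := by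
  classical
  refine mem_degreeLT.2 fun m hm ↦ ?_
  rw [coeff_C, if_neg]
  rintro rfl
  simp at hm
  omega

theorem pderiv_mem_degreeLT {n : ℕ} {p : MvPolynomial τ R} (hp : p ∈ degreeLT τ R (n + 1))
    (j : τ) : pderiv j p ∈ degreeLT τ R n := by
  refine mem_degreeLT.2 fun m hm ↦ ?_
  rw [coeff_pderiv, mem_degreeLT.1 hp, zero_mul]
  rw [map_add, Finsupp.degree_single]
  omega

/-- If `m` has degree at least two and contains `j`, then `m j` times the coefficient of `m` is a
coefficient of `∂_j p` in positive degree, hence zero. Torsion-freeness removes the factor `m j`. -/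
theorem mem_degreeLT_two_of_pderiv [IsAddTorsionFree R] {p : MvPolynomial τ R}
    (hp : ∀ j, ∃ c, pderiv j p = C c) : p ∈ degreeLT τ R 2 := by
  classical
  refine mem_degreeLT.2 fun m hm ↦ ?_
  obtain ⟨j, hj⟩ : ∃ j, m j ≠ 0 := by
    by_contra! h
    have : m = 0 := Finsupp.ext h
    simp [this] at hm
  obtain ⟨c, hc⟩ := hp j
  have h1 : m - Finsupp.single j 1 + Finsupp.single j 1 = m :=
    tsub_add_cancel_of_le (Finsupp.single_le_iff.2 (Nat.one_le_iff_ne_zero.2 hj))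
  have h2 := congrArg (coeff (m - Finsupp.single j 1)) hc
  rw [coeff_pderiv, h1, coeff_C, if_neg] at h2
  · have h3 : ((m - Finsupp.single j 1 : τ →₀ ℕ) j + 1) • coeff m p = 0 := by
      rw [nsmul_eq_mul, mul_comm, Nat.cast_add, Nat.cast_one, h2]
    exact (smul_eq_zero.1 h3).resolve_left (Nat.succ_ne_zero _)
  · intro h
    rw [← h, zero_add] at h1
    rw [← h1, Finsupp.degree_single] at hm
    omega

theorem eq_of_mem_degreeLT_two {p : MvPolynomial τ R} (hp : p ∈ degreeLT τ R 2) :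
    ∃ (r : R) (s : τ →₀ R), p = C r + s.sum fun j c ↦ C c * X j := by
  classical
  replace hp : p ∈ Submodule.span R
      ((fun m ↦ monomial m (1 : R)) '' {m : τ →₀ ℕ | m.degree < 2}) := by
    rw [← restrictSupport_eq_span]; exact hp
  induction hp using Submodule.span_induction with
  | mem p hp =>
    obtain ⟨m, hm, rfl⟩ := hp
    have hm' : m.degree = 0 ∨ m.degree = 1 := by
      have : m.degree < 2 := hm
      omega
    rcases hm' with h | h
    · refine ⟨1, 0, ?_⟩
      rw [(Finsupp.degree_eq_zero_iff m).1 h]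
      simp
    · obtain ⟨j, rfl⟩ := (Finsupp.sum_eq_one_iff m).1 h
      exact ⟨0, Finsupp.single j 1, by simp [X]⟩
  | zero => exact ⟨0, 0, by simp⟩
  | add p q _ _ hp hq =>
    obtain ⟨r, s, h⟩ := hp
    obtain ⟨r', s', h'⟩ := hq
    refine ⟨r + r', s + s', ?_⟩
    rw [Finsupp.sum_add_index' (by simp) (by simp [add_mul]), h, h', C_add]
    ring
  | smul a p _ hp =>
    obtain ⟨r, s, h⟩ := hp
    refine ⟨a * r, a • s, ?_⟩
    rw [Finsupp.sum_smul_index (by simp), h, smul_eq_C_mul, mul_add, ← C_mul, Finsupp.mul_sum]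
    simp [mul_assoc]

end DegreeLT

end MvPolynomial

/-! ### Tensor squares of subalgebras and contraction by functionals -/

section Contract

variable {k B : Type*} [Field k] [CommRing B]

/-- The subalgebra `R ⊗ B` of `B ⊗ B`. -/
noncomputable def Subalgebra.tensorLeft [Algebra k B] (R : Subalgebra k B) :
    Subalgebra k (B ⊗[k] B) :=
  (Algebra.TensorProduct.map R.val (AlgHom.id k B)).range

/-- The subalgebra `R ⊗ R` of `B ⊗ B`. -/
noncomputable def Subalgebra.tensorSquare [Algebra k B] (R : Subalgebra k B) :
    Subalgebra k (B ⊗[k] B) :=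
  (Algebra.TensorProduct.map R.val R.val).range

/-- The map `b ⊗ c ↦ μ(c) b`. -/
noncomputable def contractSnd [Algebra k B] (μ : B →ₗ[k] k) : B ⊗[k] B →ₗ[k] B :=
  (TensorProduct.rid k B).toLinearMap ∘ₗ μ.lTensor B

@[simp]
theorem contractSnd_tmul [Algebra k B] (μ : B →ₗ[k] k) (b c : B) :
    contractSnd μ (b ⊗ₜ c) = μ c • b := by
  simp [contractSnd]

/-- A factor on the right of the tensor is absorbed by changing the functional. For this reason
contractibility below is stated for all functionals at once. -/
theorem contractSnd_mul_tmul [Algebra k B] (μ : B →ₗ[k] k) (w : B ⊗[k] B) (b c : B) :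
    contractSnd μ (w * b ⊗ₜ c) = contractSnd (μ ∘ₗ LinearMap.mulRight k c) w * b := by
  induction w with
  | zero => simp
  | tmul x y => simp
  | add x y hx hy => simp only [add_mul, map_add, hx, hy]

namespace Subalgebra

variable [Algebra k B] {R : Subalgebra k B}

theorem tmul_mem_tensorLeft {r : B} (hr : r ∈ R) (b : B) : r ⊗ₜ[k] b ∈ R.tensorLeft :=
  ⟨(⟨r, hr⟩ : R) ⊗ₜ b, by simp⟩

theorem tmul_mem_tensorSquare {r s : B} (hr : r ∈ R) (hs : s ∈ R) :
    r ⊗ₜ[k] s ∈ R.tensorSquare :=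
  ⟨(⟨r, hr⟩ : R) ⊗ₜ (⟨s, hs⟩ : R), by simp⟩

theorem tensorLeft_induction {p : B ⊗[k] B → Prop} (zero : p 0)
    (tmul : ∀ r ∈ R, ∀ b, p (r ⊗ₜ b)) (add : ∀ x y, p x → p y → p (x + y)) {z : B ⊗[k] B}
    (hz : z ∈ R.tensorLeft) : p z := by
  obtain ⟨w, rfl⟩ := hz
  induction w with
  | zero => simpa using zero
  | tmul r b => simpa using tmul r r.2 b
  | add x y hx hy => simpa using add _ _ hx hy

theorem tensorSquare_induction {p : B ⊗[k] B → Prop} (zero : p 0)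
    (tmul : ∀ r ∈ R, ∀ s ∈ R, p (r ⊗ₜ s)) (add : ∀ x y, p x → p y → p (x + y))
    {z : B ⊗[k] B} (hz : z ∈ R.tensorSquare) : p z := by
  obtain ⟨w, rfl⟩ := hz
  induction w with
  | zero => simpa using zero
  | tmul r s => simpa using tmul r r.2 s s.2
  | add x y hx hy => simpa using add _ _ hx hy

theorem tensorSquare_le_tensorLeft : R.tensorSquare ≤ R.tensorLeft := fun _ hz ↦
  tensorSquare_induction (zero_mem _) (fun _ hr s _ ↦ tmul_mem_tensorLeft hr s)
    (fun _ _ ↦ add_mem) hz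

theorem tensorSquare_mono {S : Subalgebra k B} (h : R ≤ S) :
    R.tensorSquare ≤ S.tensorSquare := fun _ hz ↦
  tensorSquare_induction (zero_mem _) (fun _ hr _ hs ↦ tmul_mem_tensorSquare (h hr) (h hs))
    (fun _ _ ↦ add_mem) hz

theorem tensorLeft_mono {S : Subalgebra k B} (h : R ≤ S) : R.tensorLeft ≤ S.tensorLeft :=
  fun _ hz ↦ tensorLeft_induction (zero_mem _) (fun _ hr b ↦ tmul_mem_tensorLeft (h hr) b)
    (fun _ _ ↦ add_mem) hz

theorem contractSnd_mem {z : B ⊗[k] B} (hz : z ∈ R.tensorLeft) (μ : B →ₗ[k] k) :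
    contractSnd μ z ∈ R :=
  tensorLeft_induction (p := fun z ↦ contractSnd μ z ∈ R) (by simp)
    (fun r hr b ↦ by simpa using R.smul_mem hr (μ b))
    (fun x y hx hy ↦ by simpa using add_mem hx hy) hz

theorem contractSnd_eq_zero {z : B ⊗[k] B} (hz : z ∈ R.tensorSquare) {μ : B →ₗ[k] k}
    (hμ : ∀ r ∈ R, μ r = 0) : contractSnd μ z = 0 :=
  tensorSquare_induction (p := fun z ↦ contractSnd μ z = 0) (by simp)
    (fun r _ s hs ↦ by simp [hμ s hs])
    (fun x y hx hy ↦ by simp [hx, hy]) hz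

/-- An element of `R ⊗ B` that lies in `B ⊗ R` lies in `R ⊗ R`. -/
theorem mem_tensorSquare_of_sum {ι : Type*} {z : B ⊗[k] B} (hz : z ∈ R.tensorLeft) (s : Finset ι)
    (w : ι → B ⊗[k] B) (hw : ∀ i ∈ s, w i ∈ R.tensorSquare) (b : ι → B)
    (h : z = ∑ i ∈ s, w i * b i ⊗ₜ 1) : z ∈ R.tensorSquare := by
  -- `Q` is a `k`-linear projection of `B` onto `R`. The hypothesis puts `z` in `B ⊗ R`, so `id ⊗ Q`
  -- fixes it, while the same map sends `R ⊗ B` to `R ⊗ R`.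
  obtain ⟨P, hP⟩ := (Subalgebra.toSubmodule R).subtype.exists_leftInverse_of_injective
    (Submodule.ker_subtype _)
  let Q : B →ₗ[k] B := (Subalgebra.toSubmodule R).subtype ∘ₗ P
  have hQ (r : B) (hr : r ∈ R) : Q r = r :=
    congrArg Subtype.val (LinearMap.congr_fun hP ⟨r, hr⟩)
  have hQR (b : B) : Q b ∈ R := (P b).2
  have h1 : Q.lTensor B z = z := by
    rw [h, map_sum]
    refine Finset.sum_congr rfl fun i hi ↦ ?_
    refine tensorSquare_induction (p := fun y ↦ Q.lTensor B (y * b i ⊗ₜ 1) = y * b i ⊗ₜ 1)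
      (by simp) (fun r _ s hs ↦ by simp [hQ s hs]) (fun x y hx hy ↦ ?_) (hw i hi)
    simp only [add_mul, map_add, hx, hy]
  rw [← h1]
  refine tensorLeft_induction (p := fun z ↦ Q.lTensor B z ∈ R.tensorSquare)
      (by simp) (fun r hr b ↦ ?_) (fun x y hx hy ↦ ?_) hz
  · simpa using tmul_mem_tensorSquare hr (hQR b)
  · simpa using add_mem hx hy

/-- The coordinate functional on the span of the `v i` in `B / R` extends to all of `B / R`, since
`k` is a field. -/
theorem exists_linearMap_of_linearIndependent {τ : Type*} {v : τ → B}
    (hv : LinearIndependent k ((Subalgebra.toSubmodule R).mkQ ∘ v)) (j : τ) :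
    ∃ μ : B →ₗ[k] k, (∀ r ∈ R, μ r = 0) ∧ μ (v j) = 1 ∧ ∀ i, i ≠ j → μ (v i) = 0 := by
  obtain ⟨g, hg⟩ := LinearMap.exists_extend (Finsupp.lapply j ∘ₗ hv.repr)
  have hgv (i : τ) : g ((Subalgebra.toSubmodule R).mkQ (v i)) = Finsupp.single i (1 : k) j := by
    rw [← hv.repr_eq_single i ⟨_, Submodule.subset_span ⟨i, rfl⟩⟩ rfl]
    exact LinearMap.congr_fun hg ⟨_, Submodule.subset_span ⟨i, rfl⟩⟩
  refine ⟨g ∘ₗ (Subalgebra.toSubmodule R).mkQ, fun r hr ↦ ?_, ?_, fun i hi ↦ ?_⟩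
  · rw [LinearMap.comp_apply, Submodule.mkQ_apply,
      (Submodule.Quotient.mk_eq_zero _).2 (show r ∈ Subalgebra.toSubmodule R from hr), map_zero]
  · rw [LinearMap.comp_apply, hgv, Finsupp.single_eq_same]
  · rw [LinearMap.comp_apply, hgv, Finsupp.single_eq_of_ne' hi]

theorem mem_of_forall_linearMap {b : B}
    (h : ∀ μ : B →ₗ[k] k, (∀ r ∈ R, μ r = 0) → μ b = 0) : b ∈ R := by
  by_contra hb
  obtain ⟨f, hf, hR⟩ := Submodule.exists_le_ker_of_notMem (p := Subalgebra.toSubmodule R) hb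
  exact hf (h f fun r hr ↦ hR hr)

end Subalgebra

end Contract

/-! ### Elements primitive modulo a Hopf subalgebra -/

section HopfSubalgebra

open Coalgebra Bialgebra HopfAlgebra
open MvPolynomial hiding counit

variable {k B : Type*} [Field k] [CommRing B] [HopfAlgebra k B] {R : Subalgebra k B}

theorem counit_contractSnd_comul (μ : B →ₗ[k] k) (b : B) :
    counit (R := k) (contractSnd μ (comul b)) = μ b := by
  have h (w : B ⊗[k] B) : counit (R := k) (contractSnd μ w) =
      μ (TensorProduct.lid k B ((counit (R := k)).rTensor B w)) := by
    induction w with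
    | zero => simp
    | tmul x y => simp [mul_comm]
    | add x y hx hy => simp only [map_add, hx, hy]
  rw [h, rTensor_counit_comul]
  simp

variable (k B) in
/-- The endomorphism `x ⊗ y ↦ x S(y₁) ⊗ y₂` of `B ⊗ B`. -/
noncomputable def antipodeShear : B ⊗[k] B →ₐ[k] B ⊗[k] B :=
  Algebra.TensorProduct.lift Algebra.TensorProduct.includeLeft
    ((Algebra.TensorProduct.map (antipodeAlgHom k B) (AlgHom.id k B)).comp (comulAlgHom k B))
    fun _ _ ↦ Commute.all _ _

theorem antipodeShear_tmul (x y : B) :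
    antipodeShear k B (x ⊗ₜ y) =
      x ⊗ₜ 1 * (antipode k).rTensor B (comul y) := by
  rw [antipodeShear, Algebra.TensorProduct.lift_tmul]
  rfl

/-- In Sweedler notation, `b₁ S(b₂) ⊗ b₃ = ε(b₁) ⊗ b₂ = 1 ⊗ b`, by coassociativity and the antipode
and counit axioms. -/
theorem antipodeShear_comul (b : B) : antipodeShear k B (comul b) = 1 ⊗ₜ b := by
  have h (w : B ⊗[k] B) : antipodeShear k B w =
      (LinearMap.mul' k B ∘ₗ (antipode k).lTensor B).rTensor B
        ((TensorProduct.assoc k B B B).symm ((comul (R := k)).lTensor B w)) := by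
    induction w with
    | zero => simp
    | add x y hx hy => simp only [map_add, hx, hy]
    | tmul x y =>
      rw [antipodeShear_tmul, LinearMap.lTensor_tmul]
      induction comul (R := k) y with
      | zero => simp
      | add u v hu hv => simp only [TensorProduct.tmul_add, map_add, mul_add, hu, hv]
      | tmul u v => simp
  rw [h, coassoc_symm_apply, ← LinearMap.comp_apply, ← LinearMap.rTensor_comp,
    LinearMap.comp_assoc, mul_antipode_lTensor_comul, LinearMap.rTensor_comp,
    LinearMap.comp_apply, rTensor_counit_comul]
  simp

theorem antipodeShear_mem (hΔ : ∀ r ∈ R, comul r ∈ R.tensorSquare)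
    (hS : ∀ r ∈ R, antipode k r ∈ R) {z : B ⊗[k] B} (hz : z ∈ R.tensorSquare) :
    antipodeShear k B z ∈ R.tensorLeft := by
  refine Subalgebra.tensorSquare_induction (p := fun z ↦ antipodeShear k B z ∈ R.tensorLeft)
    (by simp) (fun r hr s hs ↦ ?_) (fun x y hx hy ↦ by simpa using add_mem hx hy) hz
  rw [antipodeShear_tmul]
  refine mul_mem (Subalgebra.tmul_mem_tensorLeft hr 1) ?_
  refine Subalgebra.tensorSquare_induction
    (p := fun z ↦ (antipode k).rTensor B z ∈ R.tensorLeft)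
    (by simp) (fun r hr s hs ↦ ?_) (fun x y hx hy ↦ by simpa using add_mem hx hy) (hΔ s hs)
  simpa using Subalgebra.tmul_mem_tensorLeft (hS r hr) s

variable {τ : Type*} {v : τ → B}

/-- Elements that are primitive modulo a Hopf subalgebra `R` and linearly independent over `k`
modulo `R` are linearly independent over `R` modulo `R`. -/
theorem eq_zero_of_sum_mem (hΔ : ∀ r ∈ R, comul r ∈ R.tensorSquare)
    (hS : ∀ r ∈ R, antipode k r ∈ R)
    (hv : ∀ t, comul (v t) - v t ⊗ₜ[k] 1 ∈ R.tensorLeft)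
    (hi : LinearIndependent k ((Subalgebra.toSubmodule R).mkQ ∘ v))
    (s : τ →₀ R) (hs : s.sum (fun t r ↦ (r : B) * v t) ∈ R) : s = 0 := by
  classical
  -- Up to an element of `R ⊗ B`, `z` is the coproduct of the given sum, so `z ∈ R ⊗ B`; its form
  -- also puts it in `B ⊗ R`. The shear turns it into `∑ v t ⊗ s t`, which still lies in `R ⊗ B`. A
  -- functional that kills `R` and is dual to one `v t` then isolates `s t`.
  let z : B ⊗[k] B := ∑ t ∈ s.support, comul (R := k) (s t : B) * v t ⊗ₜ 1
  have hzL : z ∈ R.tensorLeft := by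
    have h1 : z = comul (R := k) (s.sum (fun t r ↦ (r : B) * v t)) -
        ∑ t ∈ s.support, comul (R := k) (s t : B) * (comul (v t) - v t ⊗ₜ[k] 1) := by
      simp only [Finsupp.sum, map_sum, Bialgebra.comul_mul, mul_sub, Finset.sum_sub_distrib, z]
      abel
    rw [h1]
    exact sub_mem (Subalgebra.tensorSquare_le_tensorLeft (hΔ _ hs)) (sum_mem fun t _ ↦
      mul_mem (Subalgebra.tensorSquare_le_tensorLeft (hΔ _ (s t).2)) (hv t))
  have hz : z ∈ R.tensorSquare :=
    Subalgebra.mem_tensorSquare_of_sum hzL s.support _ (fun t _ ↦ hΔ _ (s t).2) v rfl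
  have hTz : antipodeShear k B z = ∑ t ∈ s.support, v t ⊗ₜ (s t : B) := by
    simp only [z, map_sum, map_mul, antipodeShear_comul]
    refine Finset.sum_congr rfl fun t _ ↦ ?_
    rw [antipodeShear_tmul, Bialgebra.comul_one, Algebra.TensorProduct.one_def,
      LinearMap.rTensor_tmul, antipode_one]
    simp
  have hm := antipodeShear_mem hΔ hS hz
  ext t
  obtain ⟨μ, hμR, hμt, hμ⟩ := Subalgebra.exists_linearMap_of_linearIndependent hi t
  have h0 : TensorProduct.lid k B (μ.rTensor B (antipodeShear k B z)) = 0 :=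
    Subalgebra.tensorLeft_induction
      (p := fun y ↦ TensorProduct.lid k B (μ.rTensor B y) = 0) (by simp)
      (fun r hr b ↦ by simp [hμR r hr]) (fun x y hx hy ↦ by simp [hx, hy]) hm
  rw [hTz] at h0
  simp only [map_sum, LinearMap.rTensor_tmul, TensorProduct.lid_tmul] at h0
  rw [Finset.sum_eq_single t (fun i _ hi ↦ by rw [hμ i hi, zero_smul])
    (fun h ↦ by simp [Finsupp.notMem_support_iff.1 h]), hμt, one_smul] at h0
  simpa using h0

/-- Contraction of the coproduct against a functional `μ` maps polynomials in the `v t` over `R`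
to such polynomials, lowers the degree if `μ` vanishes on `R`, and is compatible with partial
derivatives at the unit. -/
def IsContractible (R : Subalgebra k B) (v : τ → B) (q : MvPolynomial τ R) (n : ℕ) : Prop :=
  ∀ μ : B →ₗ[k] k, ∃ g ∈ degreeLT τ R (n + 1), ((∀ r ∈ R, μ r = 0) → g ∈ degreeLT τ R n) ∧
    aeval v g = contractSnd μ (comul (aeval v q)) ∧
    ∀ l, counit (R := k) (aeval v (pderiv l g)) = μ (aeval v (pderiv l q))

theorem IsContractible.C (hΔ : ∀ r ∈ R, comul r ∈ R.tensorSquare) (r : R) :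
    IsContractible R v (C r) 0 := by
  intro μ
  have h := Subalgebra.contractSnd_mem (Subalgebra.tensorSquare_le_tensorLeft (hΔ r r.2)) μ
  -- Degree less than `0` means being zero, so for `μ` vanishing on `R` the contraction itself has
  -- to vanish.
  refine ⟨MvPolynomial.C ⟨_, h⟩, C_mem_degreeLT (by simp) _, fun hμ ↦ ?_, ?_, fun l ↦ by simp⟩
  · have : (⟨_, h⟩ : R) = 0 := Subtype.ext (Subalgebra.contractSnd_eq_zero (hΔ r r.2) hμ)
    rw [this, MvPolynomial.C_0]
    exact zero_mem _
  · rw [aeval_C, aeval_C]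
    rfl

theorem IsContractible.add {p q : MvPolynomial τ R} {n : ℕ} (hp : IsContractible R v p n)
    (hq : IsContractible R v q n) : IsContractible R v (p + q) n := by
  intro μ
  obtain ⟨g, hg, hg0, hge, hgl⟩ := hp μ
  obtain ⟨h, hh, hh0, hhe, hhl⟩ := hq μ
  refine ⟨g + h, add_mem hg hh, fun hμ ↦ add_mem (hg0 hμ) (hh0 hμ), ?_, fun l ↦ ?_⟩
  · simp only [map_add, hge, hhe]
  · simp only [map_add, hgl, hhl]

theorem IsContractible.mono {q : MvPolynomial τ R} {m n : ℕ} (h : IsContractible R v q m)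
    (hmn : m ≤ n) : IsContractible R v q n := by
  intro μ
  obtain ⟨g, hg, hg0, hge, hgl⟩ := h μ
  exact ⟨g, degreeLT_mono (by omega) hg, fun hμ ↦ degreeLT_mono hmn (hg0 hμ), hge, hgl⟩

/-- Write `Δ v_j = v_j ⊗ 1 + z` with `z ∈ R ⊗ B`. The first term multiplies the contraction of `q`
by `X j`, raising both degree bounds by one. The second contracts `q` against modified functionals,
which need not vanish on `R`, but involves no new variable. For the partial derivatives, the counit
of the first term gives `μ(∂_l q) ε(v_j) + δ_lj μ(q)` and that of the second `μ(∂_l q · (v_j -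
ε(v_j)))`. Their sum is `μ(∂_l (q X_j))`. -/
theorem IsContractible.mul_X (hv : ∀ t, comul (v t) - v t ⊗ₜ[k] 1 ∈ R.tensorLeft)
    {q : MvPolynomial τ R} {n : ℕ} (hq : IsContractible R v q n) (j : τ) :
    IsContractible R v (q * X j) (n + 1) := by
  classical
  intro μ
  have key (z : B ⊗[k] B) (hz : z ∈ R.tensorLeft) : ∃ g ∈ degreeLT τ R (n + 1),
      aeval v g = contractSnd μ (comul (aeval v q) * z) ∧
      ∀ l, counit (R := k) (aeval v (pderiv l g)) = μ (aeval v (pderiv l q) *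
        TensorProduct.lid k B ((counit (R := k)).rTensor B z)) := by
    refine Subalgebra.tensorLeft_induction (p := fun z ↦ ∃ g ∈ degreeLT τ R (n + 1),
      aeval v g = contractSnd μ (comul (aeval v q) * z) ∧
      ∀ l, counit (R := k) (aeval v (pderiv l g)) = μ (aeval v (pderiv l q) *
        TensorProduct.lid k B ((counit (R := k)).rTensor B z))) ?_ (fun r hr b ↦ ?_) ?_ hz
    · exact ⟨0, zero_mem _, by simp, by simp⟩
    · obtain ⟨g, hg, -, hge, hgl⟩ := hq (μ ∘ₗ LinearMap.mulRight k b)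
      refine ⟨(⟨r, hr⟩ : R) • g, Submodule.smul_mem _ _ hg, ?_, fun l ↦ ?_⟩
      · rw [contractSnd_mul_tmul, ← hge, map_smul, Algebra.smul_def, mul_comm]
        rfl
      · rw [Derivation.map_smul, map_smul, Algebra.smul_def, Bialgebra.counit_mul, hgl]
        change counit r * _ = _
        simp
    · rintro x y ⟨g, hg, hge, hgl⟩ ⟨h, hh, hhe, hhl⟩
      refine ⟨g + h, add_mem hg hh, ?_, fun l ↦ ?_⟩
      · simp only [map_add, mul_add, hge, hhe]
      · simp only [map_add, mul_add, hgl, hhl]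
  obtain ⟨g, hg, hge, hgl⟩ := key _ (hv j)
  obtain ⟨h, hh, hh0, hhe, hhl⟩ := hq μ
  refine ⟨h * X j + g, add_mem (mul_X_mem_degreeLT hh j) (degreeLT_mono (by omega) hg),
    fun hμ ↦ add_mem (mul_X_mem_degreeLT (hh0 hμ) j) hg, ?_, fun l ↦ ?_⟩
  · rw [map_add, map_mul (aeval v), aeval_X, hge, hhe, map_mul (aeval v), aeval_X,
      Bialgebra.comul_mul, mul_sub,
      map_sub, contractSnd_mul_tmul]
    simp
  · have h1 : TensorProduct.lid k B ((counit (R := k)).rTensor B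
        (comul (v j) - v j ⊗ₜ[k] 1)) = v j - algebraMap k B (counit (v j)) := by
      rw [map_sub, map_sub, rTensor_counit_comul]
      simp [Algebra.algebraMap_eq_smul_one]
    have h2 : counit (R := k) (aeval v h) = μ (aeval v q) := by
      rw [hhe, counit_contractSnd_comul]
    rw [map_add, map_add, map_add, hgl, h1, pderiv_mul, pderiv_mul, pderiv_X]
    simp only [map_add, map_mul, aeval_X, Bialgebra.counit_mul, hhl, mul_sub, map_sub]
    have h3 : μ (aeval v (pderiv l q) * algebraMap k B (counit (v j))) =
        μ (aeval v (pderiv l q)) * counit (v j) := by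
      rw [mul_comm, ← Algebra.smul_def, map_smul, smul_eq_mul, mul_comm]
    rw [h3]
    by_cases hlj : l = j
    · subst hlj
      simp [h2]
      ring
    · simp [Pi.single_eq_of_ne' hlj]

theorem isContractible_of_mem_degreeLT (hΔ : ∀ r ∈ R, comul r ∈ R.tensorSquare)
    (hv : ∀ t, comul (v t) - v t ⊗ₜ[k] 1 ∈ R.tensorLeft) {q : MvPolynomial τ R} {n : ℕ}
    (hq : q ∈ degreeLT τ R (n + 1)) : IsContractible R v q n := by
  have hmon (d : ℕ) : ∀ (m : τ →₀ ℕ) (r : R), m.degree = d →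
      IsContractible R v (monomial m r) d := by
    induction d with
    | zero =>
      intro m r hm
      rw [(Finsupp.degree_eq_zero_iff m).1 hm]
      exact IsContractible.C hΔ r
    | succ d ih =>
      intro m r hm
      obtain ⟨j, hj⟩ : ∃ j, m j ≠ 0 := by
        by_contra! h
        rw [show m = 0 from Finsupp.ext h, map_zero] at hm
        omega
      have h1 : m - Finsupp.single j 1 + Finsupp.single j 1 = m :=
        tsub_add_cancel_of_le (Finsupp.single_le_iff.2 (Nat.one_le_iff_ne_zero.2 hj))
      rw [← h1, monomial_add_single, pow_one]
      refine (ih _ r ?_).mul_X hv j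
      rw [← h1, map_add, Finsupp.degree_single] at hm
      omega
  rw [q.as_sum]
  refine Finset.sum_induction _ (IsContractible R v · n) (fun _ _ ↦ IsContractible.add)
    (by simpa using (IsContractible.C hΔ (0 : R)).mono n.zero_le) fun m hm ↦ ?_
  refine (hmon _ m _ rfl).mono ?_
  by_contra! h
  exact mem_support_iff.1 hm (mem_degreeLT.1 hq m h)

/-- Elements that are primitive modulo a Hopf subalgebra `R` and linearly independent over `k`
modulo `R` are algebraically independent over `R`. -/
theorem algebraicIndependent_of_linearIndependent [CharZero k]
    (hΔ : ∀ r ∈ R, comul r ∈ R.tensorSquare) (hS : ∀ r ∈ R, antipode k r ∈ R)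
    (hv : ∀ t, comul (v t) - v t ⊗ₜ[k] 1 ∈ R.tensorLeft)
    (hi : LinearIndependent k ((Subalgebra.toSubmodule R).mkQ ∘ v)) :
    AlgebraicIndependent R v := by
  have : IsAddTorsionFree R := ⟨fun n hn x y h ↦ by
    simp only [← Nat.cast_smul_eq_nsmul k] at h
    exact smul_right_injective R (Nat.cast_ne_zero.2 hn) h⟩
  -- A relation of degree at most one is excluded by linear independence over `R` modulo `R`.
  have h2 (q : MvPolynomial τ R) (hq : q ∈ degreeLT τ R 2) (h0 : aeval v q = 0) : q = 0 := by
    obtain ⟨r, s, rfl⟩ := eq_of_mem_degreeLT_two hq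
    have hsum : aeval v (s.sum fun j c ↦ C c * X j) = s.sum fun t r ↦ (r : B) * v t := by
      rw [Finsupp.sum, map_sum]
      exact Finset.sum_congr rfl fun t _ ↦ by rw [map_mul, aeval_C, aeval_X]; rfl
    rw [map_add, hsum, aeval_C] at h0
    have hs : s = 0 := eq_zero_of_sum_mem hΔ hS hv hi s
      (by rw [eq_neg_of_add_eq_zero_right h0]; exact neg_mem r.2)
    subst hs
    have hr : r = 0 := Subtype.ext (by simpa using h0)
    simp [hr]
  have hn (n : ℕ) : ∀ q ∈ degreeLT τ R (n + 2), aeval v q = 0 → q = 0 := by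
    induction n with
    | zero => exact h2
    | succ n ih =>
      intro q hq h0
      refine h2 q (mem_degreeLT_two_of_pderiv fun l ↦ ?_) h0
      -- Contracting the relation by a functional that kills `R` gives a relation `g` of smaller
      -- degree, so `g = 0`. Its partial derivatives at the unit then show that the functional kills
      -- `∂_l q (v)`.
      have hmem : aeval v (pderiv l q) ∈ R := by
        refine Subalgebra.mem_of_forall_linearMap fun μ hμ ↦ ?_
        obtain ⟨g, -, hg, hge, hgl⟩ := isContractible_of_mem_degreeLT hΔ hv hq μ
        rw [h0, map_zero, map_zero] at hge
        rw [← hgl, ih g (hg hμ) hge, map_zero, map_zero, map_zero]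
      -- `∂_l q` minus its value, an element of `R`, is again a relation of smaller degree. So every
      -- `∂_l q` is constant and `q` has degree at most one.
      refine ⟨⟨_, hmem⟩, sub_eq_zero.1 (ih _ (sub_mem (pderiv_mem_degreeLT hq l)
        (C_mem_degreeLT (by omega) _)) ?_)⟩
      rw [map_sub, aeval_C, sub_eq_zero]
      rfl
  refine (injective_iff_map_eq_zero _).2 fun q h0 ↦ ?_
  obtain ⟨n, hq⟩ := exists_mem_degreeLT q
  exact hn n q (degreeLT_mono (by omega) hq) h0

end HopfSubalgebra

/-! ### Matrix coefficients of a commutative Hopf algebra -/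

/-- A square matrix over a coalgebra whose entries are comultiplied like matrix coefficients. -/
structure Matrix.IsComultiplicative (k : Type*) {B ι : Type*} [Field k] [CommRing B]
    [HopfAlgebra k B] [Fintype ι] [DecidableEq ι] (X : Matrix ι ι B) : Prop where
  comul_apply : ∀ i j, Coalgebra.comul (R := k) (X i j) = ∑ l, X i l ⊗ₜ[k] X l j
  counit_apply : ∀ i j, Coalgebra.counit (R := k) (X i j) = (1 : Matrix ι ι k) i j

section Coefficients

open Coalgebra Bialgebra HopfAlgebra

variable {k B : Type*} [Field k] [CommRing B] [HopfAlgebra k B]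

/-- A right coideal of `B`. -/
def IsRightCoideal (W : Submodule k B) : Prop :=
  ∀ w ∈ W, comul (R := k) w ∈ Submodule.map₂ (TensorProduct.mk k B B) W ⊤

theorem IsRightCoideal.sup {V W : Submodule k B} (hV : IsRightCoideal V) (hW : IsRightCoideal W) :
    IsRightCoideal (V ⊔ W) := by
  intro x hx
  obtain ⟨v, hv, w, hw, rfl⟩ := Submodule.mem_sup.1 hx
  rw [map_add]
  exact add_mem (Submodule.map₂_le_map₂_left le_sup_left (hV v hv))
    (Submodule.map₂_le_map₂_left le_sup_right (hW w hw))

theorem comul_contractSnd (μ : B →ₗ[k] k) (w : B ⊗[k] B) :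
    comul (R := k) (contractSnd μ w) =
      TensorProduct.rid k (B ⊗[k] B) (μ.lTensor (B ⊗[k] B) ((comul (R := k)).rTensor B w)) := by
  induction w with
  | zero => simp
  | tmul x y => simp
  | add x y hx hy => simp only [map_add, hx, hy]

theorem rid_lTensor_assoc_symm (μ : B →ₗ[k] k) (b : B) (w : B ⊗[k] B) :
    TensorProduct.rid k (B ⊗[k] B) (μ.lTensor (B ⊗[k] B)
      ((TensorProduct.assoc k B B B).symm (b ⊗ₜ w))) = b ⊗ₜ contractSnd μ w := by
  induction w with
  | zero => simp
  | tmul x y => simp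
  | add x y hx hy => simp only [map_add, TensorProduct.tmul_add, hx, hy]

/-- Expand `Δ b = ∑ f_i ⊗ e_i` along a basis `e` of `B` and take the span of the finitely many
nonzero `f_i`. By coassociativity, `Δ f_i = ∑ f_j ⊗ (id ⊗ e_i*) Δ e_j`, and the counit recovers `b`.
-/
theorem exists_isRightCoideal_mem (b : B) :
    ∃ W : Submodule k B, W.FG ∧ IsRightCoideal W ∧ b ∈ W := by
  classical
  let e := Module.Basis.ofVectorSpace k B
  let f := TensorProduct.equivFinsuppOfBasisRight e (comul (R := k) b)
  have hf : comul (R := k) b = ∑ i ∈ f.support, f i ⊗ₜ e i := by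
    rw [← (TensorProduct.equivFinsuppOfBasisRight e).symm_apply_apply (comul (R := k) b)]
    exact TensorProduct.equivFinsuppOfBasisRight_symm_apply _ _
  have hfi (i) : f i = contractSnd (e.coord i) (comul (R := k) b) := by
    by_cases hi : i ∈ f.support
    · rw [hf, map_sum, Finset.sum_eq_single i]
      · simp
      · intro j _ hj
        simp [Finsupp.single_eq_of_ne' hj]
      · exact fun h ↦ (h hi).elim
    · rw [hf, map_sum, Finsupp.notMem_support_iff.1 hi, eq_comm]
      refine Finset.sum_eq_zero fun j hj ↦ ?_
      have : j ≠ i := fun h ↦ hi (h ▸ hj)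
      simp [Finsupp.single_eq_of_ne' this]
  refine ⟨Submodule.span k (f '' f.support), ?_, ?_, ?_⟩
  · exact ⟨f.support.image f, by simp⟩
  · intro w hw
    induction hw using Submodule.span_induction with
    | zero => simp
    | add x y _ _ hx hy => rw [map_add]; exact add_mem hx hy
    | smul a x _ hx => rw [map_smul]; exact Submodule.smul_mem _ a hx
    | mem x hx =>
      obtain ⟨i, -, rfl⟩ := hx
      rw [hfi, comul_contractSnd, ← coassoc_symm_apply]
      rw [hf]
      simp only [map_sum, LinearMap.lTensor_tmul, rid_lTensor_assoc_symm]
      exact sum_mem fun j hj ↦ Submodule.apply_mem_map₂ _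
        (Submodule.subset_span ⟨j, hj, rfl⟩) trivial
  · have h : b = contractSnd (counit (R := k)) (comul (R := k) b) := by
      simp [contractSnd]
    rw [h, hf, map_sum]
    refine sum_mem fun i hi ↦ ?_
    rw [contractSnd_tmul]
    exact Submodule.smul_mem _ _ (Submodule.subset_span ⟨i, hi, rfl⟩)

theorem exists_isRightCoideal_subset (A : Finset B) :
    ∃ W : Submodule k B, W.FG ∧ IsRightCoideal W ∧ ∀ a ∈ A, a ∈ W := by
  classical
  induction A using Finset.induction_on with
  | empty => exact ⟨⊥, Submodule.fg_bot, fun w hw ↦ by simp [(Submodule.mem_bot k).1 hw], by simp⟩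
  | insert b A _ ih =>
    obtain ⟨W, hW, hWc, hA⟩ := ih
    obtain ⟨V, hV, hVc, hb⟩ := exists_isRightCoideal_mem (k := k) b
    refine ⟨V ⊔ W, hV.sup hW, hVc.sup hWc, fun a ha ↦ ?_⟩
    rcases Finset.mem_insert.1 ha with rfl | ha
    · exact Submodule.mem_sup_left hb
    · exact Submodule.mem_sup_right (hA a ha)

/-- The matrix is defined by `Δ w_j = ∑ w_l ⊗ X_lj`. Comparing coefficients of the independent `w_l`
in coassociativity and in one counit axiom gives the two conditions on `X`. The other counit axiom
expresses `w_j` through the entries. -/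
theorem IsRightCoideal.exists_matrix {W : Submodule k B} (hW : IsRightCoideal W) {n : ℕ}
    (w : Module.Basis (Fin n) k W) : ∃ X : Matrix (Fin n) (Fin n) B, X.IsComultiplicative k ∧
      ∀ j, (w j : B) = ∑ l, counit (R := k) (w l : B) • X l j := by
  have hex (j : Fin n) : ∃ c : Fin n → B, comul (R := k) (w j : B) = ∑ l, (w l : B) ⊗ₜ c l := by
    let F : (Fin n → B) →ₗ[k] B ⊗[k] B :=
      ∑ l, TensorProduct.mk k B B (w l) ∘ₗ LinearMap.proj l
    have hF (c : Fin n → B) : F c = ∑ l, (w l : B) ⊗ₜ c l := by simp [F]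
    have hle : Submodule.map₂ (TensorProduct.mk k B B) W ⊤ ≤ LinearMap.range F := by
      refine Submodule.map₂_le.2 fun m hm b _ ↦ ⟨fun l ↦ w.repr ⟨m, hm⟩ l • b, ?_⟩
      have h : m = ∑ l, w.repr ⟨m, hm⟩ l • (w l : B) := by
        have h := congrArg Subtype.val (w.sum_repr ⟨m, hm⟩)
        rw [Submodule.coe_sum] at h
        exact h.symm
      rw [hF, TensorProduct.mk_apply]
      conv_rhs => rw [h]
      simp [TensorProduct.sum_tmul, TensorProduct.smul_tmul]
    obtain ⟨c, hc⟩ := hle (hW (w j) (w j).2)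
    exact ⟨c, by rw [← hc, hF]⟩
  choose c hc using hex
  have hdual (l : Fin n) : ∃ μ : B →ₗ[k] k, ∀ m, μ (w m) = (1 : Matrix (Fin n) (Fin n) k) l m := by
    obtain ⟨μ, hμ⟩ := LinearMap.exists_extend (w.coord l)
    refine ⟨μ, fun m ↦ ?_⟩
    have h := LinearMap.congr_fun hμ (w m)
    simp only [LinearMap.comp_apply, Submodule.subtype_apply, Module.Basis.coord_apply,
      Module.Basis.repr_self] at h
    rw [h, Matrix.one_apply, Finsupp.single_apply]
    exact if_congr eq_comm rfl rfl
  choose μ hμ using hdual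
  refine ⟨fun l j ↦ c j l, ⟨fun i j ↦ ?_, fun i j ↦ ?_⟩, fun j ↦ ?_⟩
  · have h := coassoc_apply (R := k) (w j : B)
    simp only [hc, map_sum, LinearMap.rTensor_tmul, LinearMap.lTensor_tmul,
      TensorProduct.sum_tmul, TensorProduct.assoc_tmul] at h
    have h' := congrArg (fun z ↦ TensorProduct.lid k (B ⊗[k] B) ((μ i).rTensor _ z)) h
    simp only [map_sum, LinearMap.rTensor_tmul, TensorProduct.lid_tmul, hμ, Matrix.one_apply,
      ite_smul, one_smul, zero_smul, Finset.sum_ite_eq, Finset.mem_univ, if_true] at h'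
    exact h'.symm
  · have h := lTensor_counit_comul (R := k) (w j : B)
    have h' := congrArg (fun z ↦ TensorProduct.lid k k ((μ i).rTensor _ z)) h
    simp only [hc, map_sum, LinearMap.lTensor_tmul, LinearMap.rTensor_tmul,
      TensorProduct.lid_tmul, hμ, Matrix.one_apply, ite_mul, one_mul, zero_mul,
      Finset.sum_ite_eq, Finset.mem_univ, if_true, smul_eq_mul, mul_one] at h'
    rw [h', Matrix.one_apply]
  · have h := rTensor_counit_comul (R := k) (w j : B)
    have h' := congrArg (TensorProduct.lid k B) h
    simp only [hc, map_sum, LinearMap.rTensor_tmul, TensorProduct.lid_tmul, one_smul] at h'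
    exact h'.symm

namespace Matrix.IsComultiplicative

variable {ι : Type*} [Fintype ι] [DecidableEq ι] {X : Matrix ι ι B}

theorem mul_map_antipode (hX : X.IsComultiplicative k) : X * X.map (antipode k) = 1 := by
  ext i j
  have h := mul_antipode_lTensor_comul_apply (R := k) (X i j)
  simp only [hX.comul_apply, map_sum, LinearMap.lTensor_tmul, LinearMap.mul'_apply,
    hX.counit_apply] at h
  rw [Matrix.mul_apply]
  simp only [Matrix.map_apply, h, Matrix.one_apply]
  split_ifs <;> simp

theorem map_antipode_mul (hX : X.IsComultiplicative k) : X.map (antipode k) * X = 1 :=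
  mul_eq_one_comm.1 hX.mul_map_antipode

/-- `Δ(S(X))` is inverse to `Δ(X) = (X ⊗ 1)(1 ⊗ X)`, and so is `(1 ⊗ S(X))(S(X) ⊗ 1)`. Inverses are
unique. -/
theorem comul_antipode (hX : X.IsComultiplicative k) (i j : ι) :
    comul (R := k) (antipode k (X i j)) =
      ∑ l, antipode k (X l j) ⊗ₜ[k] antipode k (X i l) := by
  let L : B →ₐ[k] B ⊗[k] B := Algebra.TensorProduct.includeLeft
  let R : B →ₐ[k] B ⊗[k] B := Algebra.TensorProduct.includeRight
  let Y := X.map (antipode k)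
  have hXΔ : X.map (comulAlgHom k B) = X.map L * X.map R := by
    ext i j
    simp [Matrix.mul_apply, hX.comul_apply, L, R]
  have h1 : X.map (comulAlgHom k B) * Y.map (comulAlgHom k B) = 1 := by
    rw [← Matrix.map_mul, hX.mul_map_antipode, Matrix.map_one _ (map_zero _) (map_one _)]
  have hL : Y.map L * X.map L = 1 := by
    rw [← Matrix.map_mul, hX.map_antipode_mul, Matrix.map_one _ (map_zero _) (map_one _)]
  have hR : Y.map R * X.map R = 1 := by
    rw [← Matrix.map_mul, hX.map_antipode_mul, Matrix.map_one _ (map_zero _) (map_one _)]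
  have h2 : (Y.map R * Y.map L) * X.map (comulAlgHom k B) = 1 := by
    rw [hXΔ, Matrix.mul_assoc, ← Matrix.mul_assoc (Y.map L), hL, Matrix.one_mul, hR]
  have h3 : Y.map (comulAlgHom k B) = Y.map R * Y.map L := (left_inv_eq_right_inv h2 h1).symm
  have h4 := congrFun (congrFun h3 i) j
  simpa [Matrix.mul_apply, L, R, Y] using h4

/-- The antipode reverses the order of the matrix product in the coproduct, and transposing restores
it. -/
theorem map_antipode_transpose (hX : X.IsComultiplicative k) :
    (X.map (antipode k))ᵀ.IsComultiplicative k where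
  comul_apply i j := by
    simpa using hX.comul_antipode j i
  counit_apply i j := by
    simp [hX.counit_apply, Matrix.one_apply, eq_comm]

/-- Both `S(S(X))` and `X` are inverse to `S(X)`. -/
theorem map_antipode_map_antipode (hX : X.IsComultiplicative k) :
    (X.map (antipode k)).map (antipode k) = X := by
  refine left_inv_eq_right_inv (a := X.map (antipode k)) ?_ hX.map_antipode_mul
  change (X.map (antipode k)).map (antipodeAlgHom k B) * X.map (antipodeAlgHom k B) = 1
  rw [← Matrix.map_mul, hX.map_antipode_mul, Matrix.map_one _ (map_zero _) (map_one _)]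

theorem fromBlocks {κ : Type*} [Fintype κ] [DecidableEq κ] {Z : Matrix κ κ B}
    (hX : X.IsComultiplicative k) (hZ : Z.IsComultiplicative k) :
    (Matrix.fromBlocks X 0 0 Z).IsComultiplicative k where
  comul_apply i j := by
    rcases i with i | i <;> rcases j with j | j <;>
      simp [hX.comul_apply, hZ.comul_apply]
  counit_apply i j := by
    rcases i with i | i <;> rcases j with j | j <;>
      simp [hX.counit_apply, hZ.counit_apply, Matrix.one_apply]

end Matrix.IsComultiplicative

/-- Every finite subset of a commutative Hopf algebra lies in the span of the entries of a matrix
of matrix coefficients whose set of entries is stable under the antipode. -/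
theorem exists_isComultiplicative (A : Finset B) : ∃ (n : ℕ)
    (X : Matrix (Fin n ⊕ Fin n) (Fin n ⊕ Fin n) B), X.IsComultiplicative k ∧
      (∀ i j, ∃ i' j', antipode k (X i j) = X i' j') ∧
      ∀ a ∈ A, a ∈ Submodule.span k (Set.range fun p : (Fin n ⊕ Fin n) × (Fin n ⊕ Fin n) ↦
        X p.1 p.2) := by
  obtain ⟨W, hFG, hW, hA⟩ := exists_isRightCoideal_subset (k := k) A
  have : Module.Finite k W := Module.Finite.iff_fg.2 hFG
  obtain ⟨c, hc, hw⟩ := hW.exists_matrix (Module.finBasis k W)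
  -- The block matrix with diagonal blocks `c` and the transpose of `S(c)`. Since `S² = id` on the
  -- entries of `c`, the antipode exchanges the entries of the two blocks.
  refine ⟨_, _, hc.fromBlocks hc.map_antipode_transpose, ?_, fun a ha ↦ ?_⟩
  · have hS := hc.map_antipode_map_antipode
    rintro (i | i) (j | j)
    · exact ⟨Sum.inr j, Sum.inr i, by simp⟩
    · exact ⟨Sum.inl i, Sum.inr j, by simp⟩
    · exact ⟨Sum.inr i, Sum.inl j, by simp⟩
    · refine ⟨Sum.inl j, Sum.inl i, ?_⟩
      simpa using congrFun (congrFun hS j) i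
  · have h := congrArg Subtype.val ((Module.finBasis k W).sum_repr ⟨a, hA a ha⟩)
    change _ = a at h
    rw [← h, Submodule.coe_sum]
    refine sum_mem fun j _ ↦ ?_
    rw [Submodule.coe_smul, hw j]
    refine Submodule.smul_mem _ _ (sum_mem fun l _ ↦ Submodule.smul_mem _ _ ?_)
    exact Submodule.subset_span ⟨(Sum.inl l, Sum.inl j), by simp⟩

end Coefficients

/-! ### The order filtration and ordered monomials in a basis of `D` -/

section DerivLT

open MvPolynomial

variable (k D : Type*) {S : Type*} [Field k] [LieRing D] [CommRing S] [Algebra k S]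
  [LieRingModule D S]

/-- The `k`-span of the derivatives of `a` of order less than `n`. -/
def derivLT (n : ℕ) (a : S) : Submodule k S :=
  Submodule.span k {s | ∃ l : List D, l.length < n ∧ s = l.foldr (fun x b ↦ ⁅x, b⁆) a}

/-- The subalgebra generated by the derivatives of order less than `n` of the elements `x t`. -/
def ordLT {τ : Type*} (x : τ → S) (n : ℕ) : Subalgebra k S :=
  Algebra.adjoin k {s | ∃ t, ∃ l : List D, l.length < n ∧ s = l.foldr (fun x b ↦ ⁅x, b⁆) (x t)}

variable {k D}

theorem foldr_mem_derivLT {n : ℕ} {l : List D} (hl : l.length < n) (a : S) :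
    l.foldr (fun x b ↦ ⁅x, b⁆) a ∈ derivLT k D n a :=
  Submodule.subset_span ⟨l, hl, rfl⟩

theorem derivLT_mono {m n : ℕ} (h : m ≤ n) (a : S) : derivLT k D m a ≤ derivLT k D n a :=
  Submodule.span_mono fun _ ⟨l, hl, hs⟩ ↦ ⟨l, hl.trans_le h, hs⟩

theorem derivLT_le_ordLT {τ : Type*} (x : τ → S) (n : ℕ) (t : τ) :
    derivLT k D n (x t) ≤ Subalgebra.toSubmodule (ordLT k D x n) :=
  Submodule.span_le.2 fun _ ⟨l, hl, hs⟩ ↦ Algebra.subset_adjoin ⟨t, l, hl, hs⟩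

theorem foldr_mem_ordLT {τ : Type*} (x : τ → S) {n : ℕ} (t : τ) {l : List D} (hl : l.length < n) :
    l.foldr (fun x b ↦ ⁅x, b⁆) (x t) ∈ ordLT k D x n :=
  Algebra.subset_adjoin ⟨t, l, hl, rfl⟩

theorem mem_ordLT {τ : Type*} (x : τ → S) {n : ℕ} (hn : 0 < n) (t : τ) : x t ∈ ordLT k D x n :=
  foldr_mem_ordLT (l := []) x t hn

theorem ordLT_mono {τ : Type*} (x : τ → S) {m n : ℕ} (h : m ≤ n) :
    ordLT k D x m ≤ ordLT k D x n :=
  Algebra.adjoin_mono fun _ ⟨t, l, hl, hs⟩ ↦ ⟨t, l, hl.trans_le h, hs⟩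

theorem exists_mem_ordLT {τ : Type*} (x : τ → S)
    (hx : Algebra.adjoin k {s : S | ∃ t, ∃ l : List D, s = l.foldr (fun x b ↦ ⁅x, b⁆) (x t)} = ⊤)
    (s : S) : ∃ n, s ∈ ordLT k D x n := by
  have hs : s ∈ Algebra.adjoin k
      {s : S | ∃ t, ∃ l : List D, s = l.foldr (fun x b ↦ ⁅x, b⁆) (x t)} := by
    rw [hx]; trivial
  induction hs using Algebra.adjoin_induction with
  | mem s hs =>
    obtain ⟨t, l, rfl⟩ := hs
    exact ⟨_, foldr_mem_ordLT x t l.length.lt_succ_self⟩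
  | algebraMap r => exact ⟨0, Subalgebra.algebraMap_mem _ r⟩
  | add a b _ _ ha hb =>
    obtain ⟨m, hm⟩ := ha
    obtain ⟨n, hn⟩ := hb
    exact ⟨max m n, add_mem (ordLT_mono x (le_max_left m n) hm)
      (ordLT_mono x (le_max_right m n) hn)⟩
  | mul a b _ _ ha hb =>
    obtain ⟨m, hm⟩ := ha
    obtain ⟨n, hn⟩ := hb
    exact ⟨max m n, mul_mem (ordLT_mono x (le_max_left m n) hm)
      (ordLT_mono x (le_max_right m n) hn)⟩

section Map

variable {T : Type*} [CommRing T] [Algebra k T] [LieRingModule D T]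

theorem DiffAlgebra.IsDiffHom.map_foldr {f : S →ₐ[k] T} (hf : DiffAlgebra.IsDiffHom D f)
    (l : List D) (a : S) : f (l.foldr (fun x b ↦ ⁅x, b⁆) a) =
      l.foldr (fun x b ↦ ⁅x, b⁆) (f a) := by
  induction l with
  | nil => rfl
  | cons x l ih => rw [List.foldr_cons, hf, ih, List.foldr_cons]

theorem DiffAlgebra.IsDiffHom.map_ordLT {f : S →ₐ[k] T} (hf : DiffAlgebra.IsDiffHom D f)
    {τ : Type*} (x : τ → S) (n : ℕ) :
    (ordLT k D x n).map f = ordLT k D (fun t ↦ f (x t)) n := by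
  rw [ordLT, AlgHom.map_adjoin]
  congr 1
  ext s
  constructor
  · rintro ⟨_, ⟨t, l, hl, rfl⟩, rfl⟩
    exact ⟨t, l, hl, hf.map_foldr l _⟩
  · rintro ⟨t, l, hl, rfl⟩
    exact ⟨_, ⟨t, l, hl, rfl⟩, hf.map_foldr l _⟩

end Map

/-- The derivative of `a` by the monomial `∏ (b i)ⁱ`, the factors being put in some order. -/
noncomputable def monomialDeriv {d : ℕ} (b : Fin d → D) (a : S) (m : Fin d →₀ ℕ) : S :=
  (m.toMultiset.toList.map b).foldr (fun x b ↦ ⁅x, b⁆) a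

variable (k) in
/-- The `k`-linear map sending a monomial to the corresponding derivative of `a`. -/
noncomputable def polyDeriv {d : ℕ} (b : Fin d → D) (a : S) : MvPolynomial (Fin d) k →ₗ[k] S :=
  (basisMonomials (Fin d) k).constr k (monomialDeriv b a)

theorem polyDeriv_monomial_one {d : ℕ} (b : Fin d → D) (a : S) (m : Fin d →₀ ℕ) :
    polyDeriv k b a (monomial m 1) = monomialDeriv b a m := by
  have h := (basisMonomials (Fin d) k).constr_basis k (monomialDeriv b a) m
  rwa [coe_basisMonomials] at h

theorem monomialDeriv_mem {d : ℕ} (b : Fin d → D) (a : S) {m : Fin d →₀ ℕ} {n : ℕ}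
    (hm : m.degree < n) :
    monomialDeriv b a m ∈ derivLT k D n a := by
  refine foldr_mem_derivLT ?_ a
  rwa [List.length_map, Multiset.length_toList, Finsupp.card_toMultiset]

theorem degreeLT_induction {d n : ℕ} {p : MvPolynomial (Fin d) k → Prop}
    {f : MvPolynomial (Fin d) k} (hf : f ∈ degreeLT (Fin d) k n) (zero : p 0)
    (add : ∀ f g, p f → p g → p (f + g))
    (smul : ∀ (c : k) (m : Fin d →₀ ℕ), m.degree < n → p (c • monomial m 1)) : p f := by
  rw [f.as_sum]
  refine Finset.sum_induction _ p add zero fun m hm ↦ ?_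
  have h := smul (coeff m f) m (by
    by_contra! h
    exact mem_support_iff.1 hm (mem_degreeLT.1 hf m h))
  rwa [smul_monomial, smul_eq_mul, mul_one] at h

theorem polyDeriv_mem {d : ℕ} (b : Fin d → D) (a : S) {n : ℕ} {f : MvPolynomial (Fin d) k}
    (hf : f ∈ degreeLT (Fin d) k n) : polyDeriv k b a f ∈ derivLT k D n a := by
  refine degreeLT_induction (p := fun f ↦ polyDeriv k b a f ∈ derivLT k D n a) hf (by simp)
    (fun f g hf hg ↦ by rw [map_add]; exact add_mem hf hg) fun c m hm ↦ ?_
  rw [map_smul, polyDeriv_monomial_one]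
  exact Submodule.smul_mem _ _ (monomialDeriv_mem b a hm)

variable [Module k D] [LieRingModule D k] [DiffAlgebra k D S]

theorem DiffAlgebra.sum_smul_lie {ι : Type*} (s : Finset ι) (c : ι → k) (x : ι → D) (a : S) :
    ⁅∑ i ∈ s, c i • x i, a⁆ = ∑ i ∈ s, c i • ⁅x i, a⁆ := by
  classical
  induction s using Finset.induction_on with
  | empty => simp
  | insert i s hi ih =>
    rw [Finset.sum_insert hi, Finset.sum_insert hi, add_lie, ih, DiffAlgebra.smul_lie]

theorem lie_mem_derivLT {n : ℕ} {a s : S} (hs : s ∈ derivLT k D n a) (x : D) :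
    ⁅x, s⁆ ∈ derivLT k D (n + 1) a := by
  induction hs using Submodule.span_induction with
  | mem s hs =>
    obtain ⟨l, hl, rfl⟩ := hs
    exact foldr_mem_derivLT (l := x :: l) (Nat.succ_lt_succ hl) a
  | zero => simp
  | add s t _ _ hs ht => rw [lie_add]; exact add_mem hs ht
  | smul c s hs' hs =>
    rw [DiffAlgebra.lie_smul]
    exact add_mem (Submodule.smul_mem _ _ hs)
      (Submodule.smul_mem _ _ (derivLT_mono n.le_succ a hs'))

theorem lie_mem_ordLT {τ : Type*} {x : τ → S} {n : ℕ} {s : S} (hs : s ∈ ordLT k D x n) (z : D) :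
    ⁅z, s⁆ ∈ ordLT k D x (n + 1) := by
  induction hs using Algebra.adjoin_induction with
  | mem s hs =>
    obtain ⟨t, l, hl, rfl⟩ := hs
    exact foldr_mem_ordLT x t (l := z :: l) (Nat.succ_lt_succ hl)
  | algebraMap r =>
    rw [DiffAlgebra.lie_algebraMap]
    exact Subalgebra.algebraMap_mem _ _
  | add a b _ _ ha hb => rw [lie_add]; exact add_mem ha hb
  | mul a b ha' hb' ha hb =>
    rw [DiffAlgebra.lie_mul k]
    exact add_mem (mul_mem (ordLT_mono x n.le_succ ha') hb)
      (mul_mem (ordLT_mono x n.le_succ hb') ha)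

/-- Permuting the derivations changes an iterated derivative by terms of lower order. -/
theorem foldr_sub_foldr_mem_derivLT {l l' : List D} (h : l.Perm l') (a : S) :
    l.foldr (fun x b ↦ ⁅x, b⁆) a - l'.foldr (fun x b ↦ ⁅x, b⁆) a ∈ derivLT k D l.length a := by
  induction h with
  | nil => simp
  | cons x _ ih =>
    rw [List.foldr_cons, List.foldr_cons, ← lie_sub]
    exact lie_mem_derivLT ih x
  | swap x y l =>
    simp only [List.foldr_cons]
    rw [← lie_lie]
    exact foldr_mem_derivLT (l := ⁅y, x⁆ :: l) (by simp) a
  | trans h1 _ ih1 ih2 =>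
    rw [← h1.length_eq] at ih2
    simpa using add_mem ih1 ih2

/-- Two errors occur, both of lower order: `b i` also differentiates the coefficients in `k`, and
the new factor has to be moved into the chosen order. -/
theorem lie_polyDeriv_sub_mem {d : ℕ} (b : Fin d → D) (a : S) {n : ℕ} {f : MvPolynomial (Fin d) k}
    (hf : f ∈ degreeLT (Fin d) k n) (i : Fin d) :
    ⁅b i, polyDeriv k b a f⁆ - polyDeriv k b a (X i * f) ∈ derivLT k D n a := by
  refine degreeLT_induction (p := fun f ↦
    ⁅b i, polyDeriv k b a f⁆ - polyDeriv k b a (X i * f) ∈ derivLT k D n a) hf (by simp)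
    (fun f g hf hg ↦ ?_) fun c m hm ↦ ?_
  · rw [mul_add, map_add, map_add, lie_add, add_sub_add_comm]
    exact add_mem hf hg
  · have h1 : X i * monomial m (1 : k) = monomial (m + Finsupp.single i 1) 1 := by
      rw [monomial_add_single, pow_one, mul_comm]
    rw [mul_smul_comm, map_smul, map_smul, h1, polyDeriv_monomial_one, polyDeriv_monomial_one,
      DiffAlgebra.lie_smul, add_sub_right_comm, ← smul_sub]
    refine add_mem (Submodule.smul_mem _ _ ?_)
      (Submodule.smul_mem _ _ (monomialDeriv_mem b a hm))
    have hperm : (i :: m.toMultiset.toList).Perm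
        (m + Finsupp.single i 1).toMultiset.toList := by
      rw [← Multiset.coe_eq_coe, Multiset.coe_toList, ← Multiset.cons_coe, Multiset.coe_toList]
      rw [Finsupp.toMultiset_add, Finsupp.toMultiset_single, one_smul, add_comm,
        Multiset.singleton_add]
    refine derivLT_mono ?_ a (foldr_sub_foldr_mem_derivLT (hperm.map b) a)
    rw [List.length_map, List.length_cons, Multiset.length_toList, Finsupp.card_toMultiset]
    exact hm

/-- The spanning half of a Poincaré–Birkhoff–Witt statement: expand the outermost derivation in the
basis and reorder modulo lower order. -/
theorem exists_polyDeriv_eq {d : ℕ} (b : Module.Basis (Fin d) k D) (a : S) (n : ℕ) {s : S}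
    (hs : s ∈ derivLT k D n a) : ∃ f ∈ degreeLT (Fin d) k n, polyDeriv k b a f = s := by
  suffices h : derivLT k D n a ≤
      ((degreeLT (Fin d) k n).restrictScalars k).map (polyDeriv k b a) from h hs
  clear hs
  induction n with
  | zero => exact Submodule.span_le.2 fun s ⟨l, hl, _⟩ ↦ (Nat.not_lt_zero _ hl).elim
  | succ n ih =>
    refine Submodule.span_le.2 ?_
    rintro s ⟨l, hl, rfl⟩
    have hle : derivLT k D n a ≤
        ((degreeLT (Fin d) k (n + 1)).restrictScalars k).map (polyDeriv k b a) :=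
      ih.trans (Submodule.map_mono (degreeLT_mono n.le_succ))
    cases l with
    | nil =>
      refine ⟨monomial 0 1, C_mem_degreeLT n.succ_pos 1, ?_⟩
      rw [polyDeriv_monomial_one]
      simp [monomialDeriv]
    | cons x l =>
      obtain ⟨f, hf, hfl⟩ := ih (foldr_mem_derivLT (Nat.lt_of_succ_lt_succ hl) a)
      rw [SetLike.mem_coe, List.foldr_cons, ← hfl, ← b.sum_repr x, DiffAlgebra.sum_smul_lie]
      refine sum_mem fun i _ ↦ Submodule.smul_mem _ _ ?_
      rw [← sub_add_cancel ⁅b i, polyDeriv k b a f⁆ (polyDeriv k b a (X i * f))]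
      refine add_mem (hle (lie_polyDeriv_sub_mem b a hf i)) ⟨_, ?_, rfl⟩
      rw [mul_comm]
      exact mul_X_mem_degreeLT hf i

theorem ordLT_fg {d : ℕ} (b : Module.Basis (Fin d) k D) {τ : Type*} [Finite τ] (x : τ → S) (n : ℕ) :
    (ordLT k D x n).FG := by
  have hfin : {s : S | ∃ t, ∃ m : Fin d →₀ ℕ, m.degree < n ∧
      s = monomialDeriv b (x t) m}.Finite := by
    have h := (Set.finite_univ (α := τ)).prod (Finsupp.finite_of_degree_lt (σ := Fin d) n)
    refine (h.image fun p ↦ monomialDeriv b (x p.1) p.2).subset ?_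
    rintro s ⟨t, m, hm, rfl⟩
    exact ⟨(t, m), ⟨trivial, hm⟩, rfl⟩
  refine Subalgebra.fg_def.2 ⟨_, hfin, le_antisymm (Algebra.adjoin_le ?_) (Algebra.adjoin_le ?_)⟩
  · rintro s ⟨t, m, hm, rfl⟩
    exact derivLT_le_ordLT x n t (monomialDeriv_mem b _ hm)
  · rintro s ⟨t, l, hl, rfl⟩
    obtain ⟨f, hf, hfl⟩ := exists_polyDeriv_eq b (x t) n (foldr_mem_derivLT (k := k) hl (x t))
    rw [← hfl]
    refine degreeLT_induction (p := fun f ↦ polyDeriv k b (x t) f ∈ Algebra.adjoin k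
      {s : S | ∃ t, ∃ m : Fin d →₀ ℕ, m.degree < n ∧ s = monomialDeriv b (x t) m}) hf
      (by simp) (fun f g hf hg ↦ by rw [map_add]; exact add_mem hf hg) fun c m hm ↦ ?_
    rw [map_smul, polyDeriv_monomial_one]
    refine Subalgebra.smul_mem _ (Algebra.subset_adjoin ?_) c
    exact ⟨t, m, hm, rfl⟩

end DerivLT

/-! ### Graded submodules are generated in bounded degree -/

section Stabilization

open MvPolynomial

variable {k κ : Type*} [Field k] {d : ℕ}

theorem monomial_smul_mem_of_X_smul_mem {M : ℕ → Submodule k (κ → MvPolynomial (Fin d) k)}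
    (hX : ∀ n, 1 ≤ n → ∀ i, ∀ p ∈ M n, (X i : MvPolynomial (Fin d) k) • p ∈ M (n + 1))
    {j : ℕ} (hj : 1 ≤ j) {p : κ → MvPolynomial (Fin d) k} (hp : p ∈ M j) (e : ℕ) :
    ∀ m : Fin d →₀ ℕ, m.degree = e → monomial m (1 : k) • p ∈ M (j + e) := by
  induction e with
  | zero =>
    intro m hm
    rw [(Finsupp.degree_eq_zero_iff m).1 hm]
    change (1 : MvPolynomial (Fin d) k) • p ∈ _
    rwa [one_smul]
  | succ e ih =>
    intro m hm
    obtain ⟨i, hi⟩ : ∃ i, m i ≠ 0 := by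
      by_contra! h
      rw [show m = 0 from Finsupp.ext h, map_zero] at hm
      omega
    have h1 : m - Finsupp.single i 1 + Finsupp.single i 1 = m :=
      tsub_add_cancel_of_le (Finsupp.single_le_iff.2 (Nat.one_le_iff_ne_zero.2 hi))
    rw [← h1, monomial_add_single, pow_one, mul_comm, mul_smul]
    refine hX (j + e) (by omega) i _ (ih _ ?_)
    rw [← h1, map_add, Finsupp.degree_single] at hm
    omega

/-- A graded submodule of a free module of finite rank over a polynomial ring is generated in
bounded degrees. -/
theorem exists_forall_mem_span_X_smul [Finite κ]
    (M : ℕ → Submodule k (κ → MvPolynomial (Fin d) k))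
    (hM : ∀ n, ∀ p ∈ M n, ∀ t, (p t).IsHomogeneous n)
    (hX : ∀ n, 1 ≤ n → ∀ i, ∀ p ∈ M n, (X i : MvPolynomial (Fin d) k) • p ∈ M (n + 1)) :
    ∃ n₀, 1 ≤ n₀ ∧ ∀ n, n₀ ≤ n → ∀ p ∈ M (n + 1),
      p ∈ Submodule.span k {q | ∃ i, ∃ r ∈ M n, q = (X i : MvPolynomial (Fin d) k) • r} := by
  -- `N n` is generated by the pieces of degrees `1` to `n`. The chain stabilizes because the free
  -- module is Noetherian.
  let N : ℕ →o Submodule (MvPolynomial (Fin d) k) (κ → MvPolynomial (Fin d) k) :=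
    ⟨fun n ↦ Submodule.span _ {p | ∃ j, 1 ≤ j ∧ j ≤ n ∧ p ∈ M j}, fun m n h ↦
      Submodule.span_mono fun p ⟨j, h1, h2, h3⟩ ↦ ⟨j, h1, h2.trans h, h3⟩⟩
  obtain ⟨n₀, hn₀⟩ := monotone_stabilizes_iff_noetherian.2 inferInstance N
  refine ⟨max n₀ 1, le_max_right _ _, fun n hn p hp ↦ ?_⟩
  have hn1 : 1 ≤ n := (le_max_right _ _).trans hn
  have hpN : p ∈ N n := by
    rw [← hn₀ n ((le_max_left _ _).trans hn),
      hn₀ (n + 1) (((le_max_left _ _).trans hn).trans n.le_succ)]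
    exact Submodule.subset_span ⟨n + 1, by omega, le_rfl, hp⟩
  set U := Submodule.span k {q | ∃ i, ∃ r ∈ M n, q = (X i : MvPolynomial (Fin d) k) • r} with hU
  let H : (κ → MvPolynomial (Fin d) k) →ₗ[k] (κ → MvPolynomial (Fin d) k) :=
    (homogeneousComponent (n + 1)).compLeft κ
  have hH (q : κ → MvPolynomial (Fin d) k) (t : κ) :
      H q t = homogeneousComponent (n + 1) (q t) := rfl
  have hHM (q : κ → MvPolynomial (Fin d) k) (m : ℕ) (hq : ∀ t, (q t).IsHomogeneous m) :
      H q = if m = n + 1 then q else 0 := by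
    ext1 t
    rw [hH, homogeneousComponent_of_mem ((mem_homogeneousSubmodule _ _).2 (hq t))]
    by_cases h : m = n + 1
    · simp [h]
    · simp [h, Ne.symm h]
  -- Take the component of degree `n + 1` of a multiple of `q`. A generator of degree `j ≤ n`
  -- reaches that degree only through monomials of positive degree, and one variable can be split
  -- off such a monomial.
  have key : ∀ q ∈ N n, ∀ a : MvPolynomial (Fin d) k, H (a • q) ∈ U := by
    intro q hq
    refine Submodule.span_induction (p := fun q _ ↦ ∀ a : MvPolynomial (Fin d) k, H (a • q) ∈ U)
      ?_ (by simp) (fun x y _ _ hx hy a ↦ ?_) (fun c x _ hx a ↦ ?_) hq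
    · rintro q ⟨j, hj1, hjn, hqj⟩ a
      rw [a.as_sum, Finset.sum_smul, map_sum]
      refine sum_mem fun m _ ↦ ?_
      have hc : monomial m (coeff m a) = coeff m a • monomial m (1 : k) := by
        rw [smul_monomial, smul_eq_mul, mul_one]
      rw [hc, smul_assoc, map_smul]
      refine Submodule.smul_mem _ _ ?_
      have hmem := monomial_smul_mem_of_X_smul_mem hX hj1 hqj _ m rfl
      rw [hHM _ _ (hM _ _ hmem)]
      split_ifs with h
      · obtain ⟨i, hi⟩ : ∃ i, m i ≠ 0 := by
          by_contra! h'
          rw [show m = 0 from Finsupp.ext h', map_zero] at h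
          omega
        have h1 : m - Finsupp.single i 1 + Finsupp.single i 1 = m :=
          tsub_add_cancel_of_le (Finsupp.single_le_iff.2 (Nat.one_le_iff_ne_zero.2 hi))
        rw [← h1, monomial_add_single, pow_one, mul_comm, mul_smul]
        refine Submodule.subset_span ⟨i, _, ?_, rfl⟩
        have h2 := monomial_smul_mem_of_X_smul_mem hX hj1 hqj _ (m - Finsupp.single i 1) rfl
        rw [← h1, map_add, Finsupp.degree_single] at h
        have h3 : j + Finsupp.degree (m - Finsupp.single i 1 : Fin d →₀ ℕ) = n := by omega
        rwa [h3] at h2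
      · exact zero_mem _
    · rw [smul_add, map_add]
      exact add_mem (hx a) (hy a)
    · rw [← mul_smul]
      exact hx _
  have h := key p hpN 1
  rwa [one_smul, hHM p (n + 1) (hM _ p hp), if_pos rfl] at h

end Stabilization

/-! ### Logarithmic derivatives of a matrix -/

section Twist

open MvPolynomial

variable {k D S ι : Type*} [Field k] [LieRing D] [CommRing S] [Algebra k S]
  [LieRingModule D S] [Fintype ι]

variable (k) in
/-- The map `p ↦ ∑ p i j (X i l) * Y l j`, where polynomials act as differential operators. -/
noncomputable def twistedDeriv {d : ℕ} (b : Fin d → D) (X Y : Matrix ι ι S) :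
    (ι × ι → MvPolynomial (Fin d) k) →ₗ[k] S :=
  ∑ q : ι × ι, ∑ l, LinearMap.mulRight k (Y l q.2) ∘ₗ polyDeriv k b (X q.1 l) ∘ₗ
    LinearMap.proj q

theorem twistedDeriv_apply {d : ℕ} (b : Fin d → D) (X Y : Matrix ι ι S)
    (p : ι × ι → MvPolynomial (Fin d) k) : twistedDeriv k b X Y p =
      ∑ q : ι × ι, ∑ l, polyDeriv k b (X q.1 l) (p q) * Y l q.2 := by
  simp [twistedDeriv]

theorem DiffAlgebra.IsDiffHom.map_polyDeriv {T : Type*} [CommRing T] [Algebra k T]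
    [LieRingModule D T] {f : S →ₐ[k] T} (hf : IsDiffHom D f) {d : ℕ} (b : Fin d → D) (a : S)
    (p : MvPolynomial (Fin d) k) : f (polyDeriv k b a p) = polyDeriv k b (f a) p := by
  have h : f.toLinearMap ∘ₗ polyDeriv k b a = polyDeriv k b (f a) := by
    refine (basisMonomials (Fin d) k).ext fun m ↦ ?_
    simp only [coe_basisMonomials, LinearMap.comp_apply, polyDeriv_monomial_one]
    exact hf.map_foldr _ a
  exact LinearMap.congr_fun h p

theorem DiffAlgebra.IsDiffHom.map_twistedDeriv {T : Type*} [CommRing T] [Algebra k T]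
    [LieRingModule D T] {f : S →ₐ[k] T} (hf : IsDiffHom D f) {d : ℕ} (b : Fin d → D)
    (X Y : Matrix ι ι S) (p : ι × ι → MvPolynomial (Fin d) k) :
    f (twistedDeriv k b X Y p) = twistedDeriv k b (X.map f) (Y.map f) p := by
  simp [twistedDeriv_apply, hf.map_polyDeriv]

variable [Module k D] [LieRingModule D k] [DiffAlgebra k D S]

theorem lie_sum_left {κ : Type*} (s : Finset κ) (x : D) (f : κ → S) :
    ⁅x, ∑ i ∈ s, f i⁆ = ∑ i ∈ s, ⁅x, f i⁆ :=
  map_sum (AddMonoidHom.mk' (fun a : S ↦ ⁅x, a⁆) (lie_add x)) f s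

/-- The action of `b i` on `twistedDeriv` is multiplication by `X i`, up to lower order. -/
theorem lie_twistedDeriv_sub_mem {d : ℕ} (b : Fin d → D) (X Y : Matrix ι ι S) {n : ℕ}
    (hn : 1 ≤ n) (hY : ∀ i j, Y i j ∈ ordLT k D (fun q : ι × ι ↦ X q.1 q.2) 1)
    {p : ι × ι → MvPolynomial (Fin d) k} (hp : ∀ q, p q ∈ degreeLT (Fin d) k (n + 1))
    (i : Fin d) :
    ⁅b i, twistedDeriv k b X Y p⁆ -
        twistedDeriv k b X Y ((MvPolynomial.X i : MvPolynomial (Fin d) k) • p) ∈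
      ordLT k D (fun q : ι × ι ↦ X q.1 q.2) (n + 1) := by
  simp only [twistedDeriv_apply, lie_sum_left, ← Finset.sum_sub_distrib]
  refine sum_mem fun q _ ↦ sum_mem fun l _ ↦ ?_
  rw [DiffAlgebra.lie_mul k, Pi.smul_apply, smul_eq_mul, add_sub_assoc, mul_comm (Y l q.2),
    ← sub_mul]
  refine add_mem (mul_mem ?_ ?_) (mul_mem ?_ ?_)
  · exact derivLT_le_ordLT (fun q : ι × ι ↦ X q.1 q.2) _ (q.1, l) (polyDeriv_mem b _ (hp q))
  -- The derivative of `Y` has order at most one, which is at most `n`. This is the reason for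
  -- excluding degree `0` throughout.
  · exact ordLT_mono _ (by omega) (lie_mem_ordLT (hY l q.2) (b i))
  · exact derivLT_le_ordLT (fun q : ι × ι ↦ X q.1 q.2) _ (q.1, l)
      (lie_polyDeriv_sub_mem b _ (hp q) i)
  · exact ordLT_mono _ (by omega) (hY l q.2)

end Twist

/-! ### Coproducts of derivatives -/

section Comul

open Coalgebra Bialgebra HopfAlgebra
open MvPolynomial hiding counit

variable {k D B : Type*} [Field k] [LieRing D] [Module k D]
  [LieRingModule D k]
  [CommRing B] [HopfAlgebra k B] [LieRingModule D B] [DiffHopfAlgebra k D B]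

theorem lie_mem_tensorLeft {τ : Type*} {x : τ → B} {n : ℕ} {z : B ⊗[k] B}
    (hz : z ∈ (ordLT k D x n).tensorLeft) (y : D) :
    ⁅y, z⁆ ∈ (ordLT k D x (n + 1)).tensorLeft := by
  refine Subalgebra.tensorLeft_induction
    (p := fun z ↦ ⁅y, z⁆ ∈ (ordLT k D x (n + 1)).tensorLeft) (by simp) (fun r hr b ↦ ?_)
    (fun u v hu hv ↦ by rw [lie_add]; exact add_mem hu hv) hz
  rw [DiffAlgebra.lie_tmul]
  exact add_mem (Subalgebra.tmul_mem_tensorLeft (lie_mem_ordLT hr y) _)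
    (Subalgebra.tmul_mem_tensorLeft (ordLT_mono x n.le_succ hr) _)

theorem lie_mem_tensorSquare {τ : Type*} {x : τ → B} {n : ℕ} {z : B ⊗[k] B}
    (hz : z ∈ (ordLT k D x n).tensorSquare) (y : D) :
    ⁅y, z⁆ ∈ (ordLT k D x (n + 1)).tensorSquare := by
  refine Subalgebra.tensorSquare_induction
    (p := fun z ↦ ⁅y, z⁆ ∈ (ordLT k D x (n + 1)).tensorSquare) (by simp) (fun r hr s hs ↦ ?_)
    (fun u v hu hv ↦ by rw [lie_add]; exact add_mem hu hv) hz
  rw [DiffAlgebra.lie_tmul]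
  exact add_mem
    (Subalgebra.tmul_mem_tensorSquare (lie_mem_ordLT hr y) (ordLT_mono x n.le_succ hs))
    (Subalgebra.tmul_mem_tensorSquare (ordLT_mono x n.le_succ hr) (lie_mem_ordLT hs y))

/-- In the Leibniz expansion every other term spends at least one derivation on `b`, leaving fewer
for `x t`. -/
theorem foldr_tmul_sub_mem {τ : Type*} (x : τ → B) (t : τ) (b : B) (l : List D) :
    l.foldr (fun y z ↦ ⁅y, z⁆) (x t ⊗ₜ[k] b) - l.foldr (fun y z ↦ ⁅y, z⁆) (x t) ⊗ₜ b ∈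
      (ordLT k D x l.length).tensorLeft := by
  induction l with
  | nil => simp
  | cons y l ih =>
    have h := lie_mem_tensorLeft ih y
    rw [lie_sub, DiffAlgebra.lie_tmul, ← sub_sub] at h
    have h' := add_mem h (Subalgebra.tmul_mem_tensorLeft
      (foldr_mem_ordLT (k := k) x t l.length.lt_succ_self) ⁅y, b⁆)
    rwa [sub_add_cancel] at h'

theorem foldr_lie_sum {M κ : Type*} [AddCommGroup M] [LieRingModule D M] (s : Finset κ)
    (f : κ → M) (l : List D) : l.foldr (fun y z ↦ ⁅y, z⁆) (∑ i ∈ s, f i) =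
      ∑ i ∈ s, l.foldr (fun y z ↦ ⁅y, z⁆) (f i) := by
  induction l with
  | nil => rfl
  | cons y l ih =>
    simp only [List.foldr_cons, ih]
    exact map_sum (AddMonoidHom.mk' (fun a : M ↦ ⁅y, a⁆) (lie_add y)) _ s

/-- The antipode commutes with `D` and maps entries to entries. Together with
`Matrix.IsComultiplicative.comul_mem_tensorSquare`, this makes each step of the order filtration a
Hopf subalgebra. -/
theorem Matrix.antipode_mem_ordLT {ι : Type*} {X : Matrix ι ι B}
    (hS : ∀ i j, ∃ i' j', antipode k (X i j) = X i' j') {n : ℕ}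
    {r : B} (hr : r ∈ ordLT k D (fun q : ι × ι ↦ X q.1 q.2) n) :
    antipode k r ∈ ordLT k D (fun q : ι × ι ↦ X q.1 q.2) n := by
  have h : ordLT k D (fun q : ι × ι ↦ X q.1 q.2) n ≤
      (ordLT k D (fun q : ι × ι ↦ X q.1 q.2) n).comap (antipodeAlgHom k B) := by
    refine Algebra.adjoin_le ?_
    rintro _ ⟨⟨i, j⟩, l, hl, rfl⟩
    obtain ⟨i', j', h⟩ := hS i j
    rw [SetLike.mem_coe, Subalgebra.mem_comap,
      (DiffHopfAlgebra.isDiffHom_antipode (k := k) (D := D) (B := B)).map_foldr]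
    change l.foldr _ (antipode k (X i j)) ∈ _
    rw [h]
    exact foldr_mem_ordLT (fun q : ι × ι ↦ X q.1 q.2) (i', j') hl
  exact h hr

variable {ι : Type*} [Fintype ι] [DecidableEq ι] {X : Matrix ι ι B}

theorem Matrix.IsComultiplicative.comul_foldr (hX : X.IsComultiplicative k) (i j : ι)
    (l : List D) : comul (R := k) (l.foldr (fun y z ↦ ⁅y, z⁆) (X i j)) =
      ∑ m, l.foldr (fun y z ↦ ⁅y, z⁆) (X i m ⊗ₜ[k] X m j) := by
  rw [← foldr_lie_sum, ← hX.comul_apply]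
  exact (DiffHopfAlgebra.isDiffHom_comul (k := k) (D := D) (B := B)).map_foldr l (X i j)

theorem Matrix.IsComultiplicative.comul_mem_tensorSquare (hX : X.IsComultiplicative k) {n : ℕ}
    {r : B} (hr : r ∈ ordLT k D (fun q : ι × ι ↦ X q.1 q.2) n) :
    comul r ∈ (ordLT k D (fun q : ι × ι ↦ X q.1 q.2) n).tensorSquare := by
  have h : ordLT k D (fun q : ι × ι ↦ X q.1 q.2) n ≤
      (ordLT k D (fun q : ι × ι ↦ X q.1 q.2) n).tensorSquare.comap (comulAlgHom k B) := by
    refine Algebra.adjoin_le ?_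
    rintro _ ⟨⟨i, j⟩, l, hl, rfl⟩
    change comul (R := k) (_ : B) ∈ Subalgebra.tensorSquare _
    rw [hX.comul_foldr]
    refine sum_mem fun m _ ↦ ?_
    have hl' (l : List D) : l.foldr (fun y z ↦ ⁅y, z⁆) (X i m ⊗ₜ[k] X m j) ∈
        (ordLT k D (fun q : ι × ι ↦ X q.1 q.2) (l.length + 1)).tensorSquare := by
      induction l with
      | nil =>
        exact Subalgebra.tmul_mem_tensorSquare
          (mem_ordLT (fun q : ι × ι ↦ X q.1 q.2) one_pos (i, m))
          (mem_ordLT (fun q : ι × ι ↦ X q.1 q.2) one_pos (m, j))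
      | cons y l ih => exact lie_mem_tensorSquare ih y
    exact Subalgebra.tensorSquare_mono (ordLT_mono _ hl) (hl' l)
  exact h hr

theorem Matrix.IsComultiplicative.comul_polyDeriv_sub_mem (hX : X.IsComultiplicative k) {d n : ℕ}
    (b : Fin d → D) {f : MvPolynomial (Fin d) k} (hf : f ∈ degreeLT (Fin d) k (n + 1)) (i j : ι) :
    comul (R := k) (polyDeriv k b (X i j) f) - ∑ m, polyDeriv k b (X i m) f ⊗ₜ[k] X m j ∈
      (ordLT k D (fun q : ι × ι ↦ X q.1 q.2) n).tensorLeft := by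
  refine degreeLT_induction (p := fun f ↦ comul (R := k) (polyDeriv k b (X i j) f) -
    ∑ m, polyDeriv k b (X i m) f ⊗ₜ[k] X m j ∈
      (ordLT k D (fun q : ι × ι ↦ X q.1 q.2) n).tensorLeft) hf (by simp)
    (fun f g hf hg ↦ ?_) fun c e he ↦ ?_
  · simp only [map_add, TensorProduct.add_tmul, Finset.sum_add_distrib, add_sub_add_comm]
    exact add_mem hf hg
  · simp only [map_smul, ← TensorProduct.smul_tmul', ← Finset.smul_sum, ← smul_sub]
    refine Subalgebra.smul_mem _ ?_ c
    simp only [polyDeriv_monomial_one, monomialDeriv]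
    rw [hX.comul_foldr, ← Finset.sum_sub_distrib]
    refine sum_mem fun m _ ↦ ?_
    have h := foldr_tmul_sub_mem (k := k) (fun q : ι × ι ↦ X q.1 q.2) (i, m) (X m j)
      (e.toMultiset.toList.map b)
    rw [List.length_map, Multiset.length_toList, Finsupp.card_toMultiset] at h
    exact Subalgebra.tensorLeft_mono (ordLT_mono _ (Nat.lt_succ_iff.1 he)) h

/-- Logarithmic derivatives of order `n` of `X` are primitive modulo derivatives of order less
than `n`. -/
theorem Matrix.IsComultiplicative.comul_twistedDeriv_sub_mem (hX : X.IsComultiplicative k)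
    (hS : ∀ i j, ∃ i' j', antipode k (X i j) = X i' j') {d n : ℕ} (hn : 1 ≤ n)
    (b : Fin d → D) {p : ι × ι → MvPolynomial (Fin d) k}
    (hp : ∀ q, p q ∈ degreeLT (Fin d) k (n + 1)) :
    comul (R := k) (twistedDeriv k b X (X.map (antipode k)) p) -
        twistedDeriv k b X (X.map (antipode k)) p ⊗ₜ[k] 1 ∈
      (ordLT k D (fun q : ι × ι ↦ X q.1 q.2) n).tensorLeft := by
  have hY (i j : ι) : antipode k (X i j) ∈ ordLT k D (fun q : ι × ι ↦ X q.1 q.2) n :=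
    antipode_mem_ordLT hS (mem_ordLT (fun q : ι × ι ↦ X q.1 q.2) hn (i, j))
  have hXY (i j : ι) : ∑ l, X i l * antipode k (X l j) = (1 : Matrix ι ι B) i j := by
    rw [← hX.mul_map_antipode, Matrix.mul_apply]
    rfl
  simp only [twistedDeriv_apply, map_sum, TensorProduct.sum_tmul, ← Finset.sum_sub_distrib]
  refine sum_mem fun q _ ↦ ?_
  -- The leading part of the coproduct: in the second tensor factor `X` meets `S(X)`, and the
  -- product of these two matrices is the identity, leaving `⊗ 1`.
  have h1 : ∑ l, (∑ m, polyDeriv k b (X q.1 m) (p q) ⊗ₜ[k] X m l) *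
      comul (R := k) (antipode k (X l q.2)) =
      ∑ l, (polyDeriv k b (X q.1 l) (p q) * antipode k (X l q.2)) ⊗ₜ[k] 1 := by
    simp only [hX.comul_antipode, Finset.sum_mul_sum, Algebra.TensorProduct.tmul_mul_tmul]
    rw [Finset.sum_comm]
    refine Finset.sum_congr rfl fun m _ ↦ ?_
    rw [Finset.sum_comm]
    simp only [← TensorProduct.tmul_sum, hXY, Matrix.one_apply]
    rw [Finset.sum_eq_single m (fun i _ hi ↦ by rw [if_neg (Ne.symm hi), TensorProduct.tmul_zero])
      (by simp), if_pos rfl]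
  simp only [Matrix.map_apply, Finset.sum_sub_distrib]
  rw [← h1, ← Finset.sum_sub_distrib]
  refine sum_mem fun l _ ↦ ?_
  rw [Bialgebra.comul_mul, ← sub_mul]
  exact mul_mem (hX.comul_polyDeriv_sub_mem b (hp q) q.1 l)
    (Subalgebra.tensorSquare_le_tensorLeft (hX.comul_mem_tensorSquare (hY l q.2)))

end Comul

/-! ### Symbols of the linear relations among logarithmic derivatives -/

section Symbols

open MvPolynomial

variable {k D S ι : Type*} [Field k] [LieRing D] [CommRing S] [Algebra k S]
  [LieRingModule D S] [Fintype ι]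

theorem MvPolynomial.IsHomogeneous.mem_degreeLT {τ R : Type*} [CommRing R] {n : ℕ}
    {f : MvPolynomial τ R} (hf : f.IsHomogeneous n) : f ∈ degreeLT τ R (n + 1) := by
  refine MvPolynomial.mem_degreeLT.2 fun m hm ↦ ?_
  by_contra h
  have h1 : Finsupp.weight (fun _ ↦ 1) m = n := hf h
  rw [← Finsupp.degree_eq_weight_one] at h1
  omega

variable (k) in
/-- The homogeneous symbols of degree `n` for which the corresponding combination of logarithmic
derivatives of `X` is of lower order. -/
noncomputable def symbolSubmodule {d : ℕ} (b : Fin d → D) (X Y : Matrix ι ι S) (n : ℕ) :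
    Submodule k (ι × ι → MvPolynomial (Fin d) k) :=
  Submodule.pi Set.univ (fun _ ↦ homogeneousSubmodule (Fin d) k n) ⊓
    (Subalgebra.toSubmodule (ordLT k D (fun q : ι × ι ↦ X q.1 q.2) n)).comap
      (twistedDeriv k b X Y)

theorem mem_symbolSubmodule {d : ℕ} {b : Fin d → D} {X Y : Matrix ι ι S} {n : ℕ}
    {p : ι × ι → MvPolynomial (Fin d) k} : p ∈ symbolSubmodule k b X Y n ↔
      (∀ q, (p q).IsHomogeneous n) ∧
        twistedDeriv k b X Y p ∈ ordLT k D (fun q : ι × ι ↦ X q.1 q.2) n := by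
  simp [symbolSubmodule]

variable [Module k D] [LieRingModule D k] [DiffAlgebra k D S]

/-- Differentiating a relation by `b i` gives a relation of the next order, and its symbol is
multiplied by `X i`. -/
theorem X_smul_mem_symbolSubmodule {d : ℕ} {b : Fin d → D} {X Y : Matrix ι ι S}
    (hY : ∀ i j, Y i j ∈ ordLT k D (fun q : ι × ι ↦ X q.1 q.2) 1) {n : ℕ} (hn : 1 ≤ n)
    (i : Fin d) {p : ι × ι → MvPolynomial (Fin d) k} (hp : p ∈ symbolSubmodule k b X Y n) :
    (MvPolynomial.X i : MvPolynomial (Fin d) k) • p ∈ symbolSubmodule k b X Y (n + 1) := by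
  obtain ⟨h1, h2⟩ := mem_symbolSubmodule.1 hp
  refine mem_symbolSubmodule.2 ⟨fun q ↦ ?_, ?_⟩
  · rw [add_comm]
    exact (isHomogeneous_X k i).mul (h1 q)
  · have h := sub_mem (lie_mem_ordLT h2 (b i))
      (lie_twistedDeriv_sub_mem b X Y hn hY (fun q ↦ (h1 q).mem_degreeLT) i)
    rwa [sub_sub_cancel] at h

end Symbols

/-! ### The kernel of `π`, one order at a time -/

section Kernel

open Coalgebra Bialgebra HopfAlgebra
open MvPolynomial hiding counit

variable {k D A B ι : Type*} [Field k] [LieRing D] [Module k D]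
  [LieRingModule D k] [CommRing A] [Algebra k A] [LieRingModule D A] [DiffAlgebra k D A]
  [CommRing B] [Fintype ι]

/-- A symbol of degree `m` in the relation module lifts to an element of `ker π` of order at most
`m`, which lies in `J` by assumption. Applying `b i` stays in `J`, so the logarithmic derivative
with symbol `X i • q` is congruent modulo `J` to an element of order at most `m`. -/
theorem exists_sub_mem_of_mem_symbolSubmodule [Algebra k B] [LieRingModule D B]
    {π : A →ₐ[k] B} (hπ : DiffAlgebra.IsDiffHom D π)
    {d : ℕ} {b : Fin d → D} {T Y : Matrix ι ι A}
    (hY : ∀ i j, Y i j ∈ ordLT k D (fun q : ι × ι ↦ T q.1 q.2) 1) {m : ℕ} (hm : 1 ≤ m)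
    (J : DiffIdeal D A)
    (hJm : ∀ f ∈ ordLT k D (fun q : ι × ι ↦ T q.1 q.2) (m + 1), π f = 0 → f ∈ J.toIdeal)
    {p : ι × ι → MvPolynomial (Fin d) k}
    (hp : p ∈ Submodule.span k {q | ∃ i, ∃ r ∈ symbolSubmodule k b (T.map π) (Y.map π) m,
      q = (X i : MvPolynomial (Fin d) k) • r}) :
    ∃ r ∈ ordLT k D (fun q : ι × ι ↦ T q.1 q.2) (m + 1),
      twistedDeriv k b T Y p - r ∈ J.toIdeal := by
  induction hp using Submodule.span_induction with
  | zero => exact ⟨0, zero_mem _, by simp⟩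
  | add p q _ _ hp hq =>
    obtain ⟨r, hr, h⟩ := hp
    obtain ⟨s, hs, h'⟩ := hq
    exact ⟨r + s, add_mem hr hs, by rw [map_add, add_sub_add_comm]; exact add_mem h h'⟩
  | smul c p _ hp =>
    obtain ⟨r, hr, h⟩ := hp
    refine ⟨c • r, Subalgebra.smul_mem _ hr c, ?_⟩
    rw [map_smul, ← smul_sub, Algebra.smul_def]
    exact Ideal.mul_mem_left _ _ h
  | mem p hp =>
    obtain ⟨i, q, hq, rfl⟩ := hp
    obtain ⟨hq1, hq2⟩ := mem_symbolSubmodule.1 hq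
    rw [← hπ.map_twistedDeriv] at hq2
    have hmap := hπ.map_ordLT (fun q : ι × ι ↦ T q.1 q.2) m
    have hq3 : π (twistedDeriv k b T Y q) ∈
        (ordLT k D (fun q : ι × ι ↦ T q.1 q.2) m).map π := by
      rw [hmap]
      exact hq2
    obtain ⟨r, hr, hrq⟩ := hq3
    have hqd (t) : q t ∈ degreeLT (Fin d) k (m + 1) := (hq1 t).mem_degreeLT
    have htw : twistedDeriv k b T Y q ∈ ordLT k D (fun q : ι × ι ↦ T q.1 q.2) (m + 1) := by
      rw [twistedDeriv_apply]
      exact sum_mem fun t _ ↦ sum_mem fun l _ ↦ mul_mem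
        (derivLT_le_ordLT (fun q : ι × ι ↦ T q.1 q.2) _ (t.1, l) (polyDeriv_mem b _ (hqd t)))
        (ordLT_mono _ (by omega) (hY l t.2))
    have h0 : twistedDeriv k b T Y q - r ∈ J.toIdeal :=
      hJm _ (sub_mem htw (ordLT_mono _ m.le_succ hr)) (by rw [map_sub, sub_eq_zero]; exact hrq.symm)
    have h1 := J.lie_mem (b i) _ h0
    rw [lie_sub] at h1
    have h2 := lie_twistedDeriv_sub_mem b T Y hm hY hqd i
    refine ⟨⁅b i, r⁆ - (⁅b i, twistedDeriv k b T Y q⁆ -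
      twistedDeriv k b T Y ((X i : MvPolynomial (Fin d) k) • q)),
      sub_mem (lie_mem_ordLT hr _) h2, ?_⟩
    rw [show twistedDeriv k b T Y ((X i : MvPolynomial (Fin d) k) • q) - (⁅b i, r⁆ -
      (⁅b i, twistedDeriv k b T Y q⁆ -
        twistedDeriv k b T Y ((X i : MvPolynomial (Fin d) k) • q))) =
      ⁅b i, twistedDeriv k b T Y q⁆ - ⁅b i, r⁆ by ring]
    exact h1

variable [DecidableEq ι]

/-- Modulo `J`, derivatives of order `n` are polynomials in logarithmic derivatives of order `n`
and derivatives of lower order. -/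
theorem ordLT_succ_le {d : ℕ} (b : Module.Basis (Fin d) k D) {T Y : Matrix ι ι A} {n : ℕ}
    (J : DiffIdeal D A) (hYT : ∀ i j, (Y * T - 1) i j ∈ J.toIdeal) (C : Subalgebra k A)
    (hJC : ∀ f ∈ J.toIdeal, f ∈ C)
    (hn : ordLT k D (fun q : ι × ι ↦ T q.1 q.2) n ≤ C) (hT : ∀ i j, T i j ∈ C)
    (hC : ∀ p : ι × ι → MvPolynomial (Fin d) k, (∀ q, (p q).IsHomogeneous n) →
      twistedDeriv k b T Y p ∈ C) :
    ordLT k D (fun q : ι × ι ↦ T q.1 q.2) (n + 1) ≤ C := by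
  have hhom (i j : ι) (f : MvPolynomial (Fin d) k) (hf : f.IsHomogeneous n) :
      polyDeriv k b (T i j) f ∈ C := by
    have h1 (l : ι) : twistedDeriv k b T Y (Pi.single (i, l) f) =
        ∑ m, polyDeriv k b (T i m) f * Y m l := by
      rw [twistedDeriv_apply, Finset.sum_eq_single (i, l)]
      · simp
      · intro q _ hq
        simp [Pi.single_eq_of_ne hq]
      · simp
    -- For the operator `f`, this is `f(T) = (f(T) Y) T - f(T) (Y T - 1)`, where the last term lies
    -- in `J`.
    have h2 : polyDeriv k b (T i j) f =
        ∑ l, twistedDeriv k b T Y (Pi.single (i, l) f) * T l j -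
          ∑ m, polyDeriv k b (T i m) f * (Y * T - 1) m j := by
      simp only [h1, Finset.sum_mul, Matrix.sub_apply, mul_sub, Finset.sum_sub_distrib,
        Matrix.mul_apply, Finset.mul_sum]
      rw [Finset.sum_comm]
      simp [Matrix.one_apply, mul_assoc]
    rw [h2]
    refine sub_mem (sum_mem fun l _ ↦ mul_mem (hC _ fun q ↦ ?_) (hT l j))
      (hJC _ (sum_mem fun m _ ↦ Ideal.mul_mem_left _ _ (hYT m j)))
    by_cases hq : q = (i, l)
    · subst hq
      simpa using hf
    · rw [Pi.single_eq_of_ne hq]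
      exact isHomogeneous_zero _ _ _
  refine Algebra.adjoin_le ?_
  rintro _ ⟨⟨i, j⟩, l, hl, rfl⟩
  obtain ⟨f, hf, hfl⟩ := exists_polyDeriv_eq b (T i j) (n + 1)
    (foldr_mem_derivLT (k := k) hl (T i j))
  change _ ∈ C
  rw [← hfl]
  refine degreeLT_induction (p := fun f ↦ polyDeriv k b (T i j) f ∈ C) hf (by simp)
    (fun f g hf hg ↦ by rw [map_add]; exact add_mem hf hg) fun c m hm ↦ ?_
  rw [map_smul]
  refine Subalgebra.smul_mem _ ?_ c
  rcases (Nat.lt_succ_iff.1 hm).lt_or_eq with h | h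
  · rw [polyDeriv_monomial_one]
    exact hn (derivLT_le_ordLT (fun q : ι × ι ↦ T q.1 q.2) n (i, j) (monomialDeriv_mem b _ h))
  · exact hhom i j _ (isHomogeneous_monomial _ h)

variable [CharZero k] [HopfAlgebra k B] [LieRingModule D B] [DiffHopfAlgebra k D B]

/-- The inductive step. Modulo `J`, an element of order at most `m + 1` is a polynomial, with
coefficients of order at most `m`, in logarithmic derivatives whose images are algebraically
independent. If it lies in `ker π`, the coefficients do too, and these are already in `J`. -/
theorem mem_of_mem_ordLT_succ {π : A →ₐ[k] B} (hπ : DiffAlgebra.IsDiffHom D π)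
    {d : ℕ} (b : Module.Basis (Fin d) k D) {T Y : Matrix ι ι A}
    (hY : ∀ i j, Y i j ∈ ordLT k D (fun q : ι × ι ↦ T q.1 q.2) 1)
    (hT : (T.map π).IsComultiplicative k)
    (hS : ∀ i j, ∃ i' j', antipode k (T.map π i j) = T.map π i' j')
    (hYT : Y.map π = (T.map π).map (antipode k)) {m : ℕ} (hm : 1 ≤ m)
    (hM : ∀ p ∈ symbolSubmodule k b (T.map π) (Y.map π) (m + 1),
      p ∈ Submodule.span k {q | ∃ i, ∃ r ∈ symbolSubmodule k b (T.map π) (Y.map π) m,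
        q = (X i : MvPolynomial (Fin d) k) • r})
    (J : DiffIdeal D A) (hJ : ∀ f ∈ J.toIdeal, π f = 0)
    (hJm : ∀ f ∈ ordLT k D (fun q : ι × ι ↦ T q.1 q.2) (m + 1), π f = 0 → f ∈ J.toIdeal) :
    ∀ f ∈ ordLT k D (fun q : ι × ι ↦ T q.1 q.2) (m + 2), π f = 0 → f ∈ J.toIdeal := by
  classical
  set An := ordLT k D (fun q : ι × ι ↦ T q.1 q.2) (m + 1) with hAn
  set R := ordLT k D (fun q : ι × ι ↦ T.map π q.1 q.2) (m + 1) with hR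
  have hmap : An.map π = R := hπ.map_ordLT _ _
  let V : Submodule k (ι × ι → MvPolynomial (Fin d) k) :=
    Submodule.pi Set.univ (fun _ ↦ homogeneousSubmodule (Fin d) k (m + 1))
  have hV (p) : p ∈ V ↔ ∀ q, (p q).IsHomogeneous (m + 1) := by simp [V]
  let φ : V →ₗ[k] B ⧸ Subalgebra.toSubmodule R :=
    (Subalgebra.toSubmodule R).mkQ ∘ₗ twistedDeriv k b (T.map π) (Y.map π) ∘ₗ V.subtype
  -- Choose symbols `e t` of degree `m + 1` whose logarithmic derivatives form a basis of all those
  -- of that degree modulo `R`. Their lifts to `A` are `u t`, and their images in `B` are `v t`.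
  obtain ⟨⟨τ, w⟩⟩ := Module.Free.exists_basis k (LinearMap.range φ)
  have hchoose (t) : ∃ p : V, φ p = w t := (w t).2
  choose e he using hchoose
  let u := fun t ↦ twistedDeriv k b T Y (e t)
  let v := fun t ↦ twistedDeriv k b (T.map π) (Y.map π) (e t)
  have huv (t) : π (u t) = v t := hπ.map_twistedDeriv b T Y _
  have hi : LinearIndependent k ((Subalgebra.toSubmodule R).mkQ ∘ v) := by
    have h1 : (Subalgebra.toSubmodule R).mkQ ∘ v = (LinearMap.range φ).subtype ∘ w :=
      funext fun t ↦ he t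
    rw [h1]
    exact w.linearIndependent.map' _ (Submodule.ker_subtype _)
  have halg : AlgebraicIndependent R v := by
    refine algebraicIndependent_of_linearIndependent (fun r hr ↦ hT.comul_mem_tensorSquare hr)
      (fun r hr ↦ Matrix.antipode_mem_ordLT hS hr) (fun t ↦ ?_) hi
    simp only [v, hYT]
    exact hT.comul_twistedDeriv_sub_mem hS (by omega) b fun q ↦
      ((hV _).1 (e t).2 q).mem_degreeLT
  let Φ : MvPolynomial τ An →ₐ[k] A := (aeval u : MvPolynomial τ An →ₐ[An] A).restrictScalars k
  -- `C` consists of the elements congruent modulo `J` to a polynomial in the `u t` over `An`.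
  let C : Subalgebra k A :=
    ((Ideal.Quotient.mkₐ k J.toIdeal).comp Φ).range.comap (Ideal.Quotient.mkₐ k J.toIdeal)
  have hC {f : A} (g) (h : Φ g - f ∈ J.toIdeal) : f ∈ C := ⟨g, Ideal.Quotient.eq.2 h⟩
  have hJC : ∀ f ∈ J.toIdeal, f ∈ C := fun f hf ↦ hC 0 (by simpa using hf)
  have hAC : An ≤ C := fun f hf ↦ hC (MvPolynomial.C ⟨f, hf⟩) (by
    have : Φ (MvPolynomial.C ⟨f, hf⟩) = f := aeval_C _ _
    rw [this, sub_self]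
    exact zero_mem _)
  have huC (t) : u t ∈ C := hC (MvPolynomial.X t) (by
    have : Φ (MvPolynomial.X t) = u t := aeval_X _ _
    rw [this, sub_self]
    exact zero_mem _)
  have hle : ordLT k D (fun q : ι × ι ↦ T q.1 q.2) (m + 2) ≤ C := by
    refine ordLT_succ_le (Y := Y) b J (fun i j ↦ ?_) C hJC hAC
      (fun i j ↦ hAC (mem_ordLT (fun q : ι × ι ↦ T q.1 q.2) (by omega) (i, j))) fun p hp ↦ ?_
    · refine hJm _ ?_ ?_
      · rw [Matrix.sub_apply, Matrix.mul_apply]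
        refine sub_mem (sum_mem fun l _ ↦ mul_mem (ordLT_mono _ (by omega) (hY i l))
          (mem_ordLT (fun q : ι × ι ↦ T q.1 q.2) (by omega) (l, j))) ?_
        rw [Matrix.one_apply]
        split_ifs
        · exact one_mem _
        · exact zero_mem _
      · have h : (Y * T - 1).map π = 0 := by
          rw [Matrix.map_sub _ (map_sub π), Matrix.map_mul, hYT, hT.map_antipode_mul,
            Matrix.map_one _ (map_zero π) (map_one π), sub_self]
        exact congrFun (congrFun h i) j
    · let c := w.repr ⟨φ ⟨p, (hV p).2 hp⟩, LinearMap.mem_range_self _ _⟩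
      let s : V := c.sum fun t a ↦ a • e t
      have hs : φ s = φ ⟨p, (hV p).2 hp⟩ := by
        have h := congrArg Subtype.val (w.linearCombination_repr
          ⟨φ ⟨p, (hV p).2 hp⟩, LinearMap.mem_range_self _ _⟩)
        refine Eq.trans ?_ h
        simp only [s, Finsupp.sum, map_sum, map_smul, he, Finsupp.linearCombination_apply]
        simp [c]
      -- Once its component along the chosen basis is subtracted, `p` becomes the symbol of a
      -- relation. By `hM` that symbol comes from degree `m`, so its logarithmic derivative has
      -- lower order modulo `J`.
      have hps : p - s ∈ symbolSubmodule k b (T.map π) (Y.map π) (m + 1) := by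
        refine mem_symbolSubmodule.2 ⟨(hV _).1 (sub_mem ((hV p).2 hp) s.2), ?_⟩
        rw [map_sub]
        exact (Submodule.Quotient.eq (Subalgebra.toSubmodule R)).1 hs.symm
      obtain ⟨r, hr, hrJ⟩ := exists_sub_mem_of_mem_symbolSubmodule hπ hY hm J hJm (hM _ hps)
      have h1 : twistedDeriv k b T Y p = twistedDeriv k b T Y s +
          ((twistedDeriv k b T Y (p - s) - r) + r) := by
        rw [map_sub]; ring
      rw [h1]
      refine add_mem ?_ (add_mem (hJC _ hrJ) (hAC hr))
      have h2 : twistedDeriv k b T Y s = c.sum fun t a ↦ a • u t := by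
        simp [s, Finsupp.sum, u]
      rw [h2]
      exact sum_mem fun t _ ↦ Subalgebra.smul_mem _ (huC t) _
  intro f hf hf0
  obtain ⟨g, hg⟩ := hle hf
  have hgJ : Φ g - f ∈ J.toIdeal := Ideal.Quotient.eq.1 hg
  have hπg : π (Φ g) = 0 := by
    have := hJ _ hgJ
    rwa [map_sub, hf0, sub_zero] at this
  let ρ : An →+* R := ((π.comp An.val).codRestrict R fun a ↦ by
    rw [← hmap]; exact ⟨a, a.2, rfl⟩ : An →ₐ[k] R)
  have hρ (a : An) : (ρ a : B) = π a := rfl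
  have hmapg : aeval v (map ρ g) = π (Φ g) := by
    change aeval v (map ρ g) = (π : A →+* B) (aeval u g)
    rw [aeval_def, eval₂_map, aeval_def, hom_eval₂]
    congr 1
    exact funext fun t ↦ (huv t).symm
  -- Algebraic independence forces `π` to kill every coefficient of `g`.
  have hg0 : map ρ g = 0 := by
    refine (injective_iff_map_eq_zero (aeval v : MvPolynomial τ R →ₐ[R] B)).1 halg _ ?_
    rw [hmapg, hπg]
  have hΦ : Φ g ∈ J.toIdeal := by
    change aeval u g ∈ _
    rw [aeval_def, eval₂_eq]
    refine sum_mem fun e _ ↦ Ideal.mul_mem_right _ _ (hJm _ (coeff e g).2 ?_)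
    have := congrArg (coeff e) hg0
    rw [coeff_map, coeff_zero] at this
    exact congrArg Subtype.val this
  rw [← sub_sub_cancel (Φ g) f]
  exact sub_mem hΦ hgJ

end Kernel

/-! ### From bounded order to finitely many generators -/

section FinitePresentation

variable {k D : Type*} [Field k] [LieRing D] [Module k D] [LieRingModule D k]

theorem DiffIdeal.span_le {S : Type*} [CommRing S] [LieRingModule D S] {A : Set S}
    {I : DiffIdeal D S} (h : A ⊆ I.toIdeal) : (DiffIdeal.span D A).toIdeal ≤ I.toIdeal :=
  sInf_le ⟨h, I.lie_mem⟩

theorem DiffIdeal.subset_span {S : Type*} [CommRing S] [LieRingModule D S] (A : Set S) :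
    A ⊆ (DiffIdeal.span D A).toIdeal := fun _ ha ↦
  Submodule.mem_sInf.2 fun _ hI ↦ hI.1 ha

/-- The kernel of a morphism of `D`-algebras. -/
def DiffAlgebra.IsDiffHom.ker {S T : Type*} [CommRing S] [Algebra k S] [LieRingModule D S]
    [CommRing T] [Algebra k T] [LieRingModule D T] {f : S →ₐ[k] T} (hf : IsDiffHom D f) :
    DiffIdeal D S where
  toIdeal := RingHom.ker f
  lie_mem x s hs := by
    rw [RingHom.mem_ker] at hs ⊢
    rw [hf, hs, lie_zero]

theorem DiffPoly.adjoin_eq_top [LieRinehartRing k D] {ι τ : Type*} (e : τ → ι)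
    (he : Function.Surjective e) :
    Algebra.adjoin k {s : DiffPoly k D ι | ∃ t, ∃ l : List D,
      s = l.foldr (fun x b ↦ ⁅x, b⁆) (T k D (e t))} = ⊤ := by
  refine eq_top_iff.2 fun f _ ↦ ?_
  obtain ⟨p, rfl⟩ := mk_surjective f
  induction p using MvPolynomial.induction_on with
  | C a => exact Subalgebra.algebraMap_mem _ a
  | add p q hp hq =>
    rw [map_add]
    exact add_mem (hp trivial) (hq trivial)
  | mul_X p v hp =>
    rw [map_mul]
    refine mul_mem (hp trivial) ?_
    obtain ⟨l, i⟩ := v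
    obtain ⟨t, rfl⟩ := he i
    rw [mk_X]
    exact Algebra.subset_adjoin ⟨t, l, rfl⟩

theorem adjoin_foldr_eq_top {S : Type*} [CommRing S] [Algebra k S] [LieRingModule D S]
    [DiffAlgebra k D S] {A : Finset S}
    (hA : Algebra.adjoin k
      {s : S | ∃ a ∈ A, ∃ l : List D, s = l.foldr (fun x b ↦ ⁅x, b⁆) a} = ⊤)
    {τ : Type*} (x : τ → S) (hx : ∀ a ∈ A, a ∈ Submodule.span k (Set.range x)) :
    Algebra.adjoin k {s : S | ∃ t, ∃ l : List D, s = l.foldr (fun x b ↦ ⁅x, b⁆) (x t)} = ⊤ := by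
  rw [eq_top_iff, ← hA]
  refine Algebra.adjoin_le ?_
  rintro _ ⟨a, ha, l, rfl⟩
  have h : ∀ l : List D, l.foldr (fun x b ↦ ⁅x, b⁆) a ∈ ordLT k D x (l.length + 1) := by
    intro l
    induction l with
    | nil =>
      refine (Submodule.span_le (p := Subalgebra.toSubmodule (ordLT k D x 1))).2 ?_ (hx a ha)
      rintro _ ⟨t, rfl⟩
      exact mem_ordLT x one_pos t
    | cons y l ih => exact lie_mem_ordLT ih y
  refine Algebra.adjoin_mono ?_ (h l)
  rintro _ ⟨t, l, -, rfl⟩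
  exact ⟨t, l, rfl⟩

/-- A `D`-ideal whose elements of order less than `n`, for each `n`, lie in the `D`-ideal generated
by its elements of order less than `m` is `D`-finitely generated. -/
theorem DiffIdeal.fg_of_forall_ordLT {S : Type*} [CommRing S] [Algebra k S] [LieRingModule D S]
    [DiffAlgebra k D S] [Module.Finite k D] {τ : Type*} [Finite τ] (x : τ → S)
    (hx : Algebra.adjoin k {s : S | ∃ t, ∃ l : List D, s = l.foldr (fun x b ↦ ⁅x, b⁆) (x t)} = ⊤)
    (I : DiffIdeal D S) (m : ℕ)
    (h : ∀ J : DiffIdeal D S, J.toIdeal ≤ I.toIdeal →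
      (∀ f ∈ ordLT k D x m, f ∈ I.toIdeal → f ∈ J.toIdeal) →
      ∀ n, ∀ f ∈ ordLT k D x n, f ∈ I.toIdeal → f ∈ J.toIdeal) : I.FG := by
  classical
  have hfg : Algebra.FiniteType k (ordLT k D x m) :=
    (Subalgebra.fg_iff_finiteType _).1 (ordLT_fg (Module.finBasis k D) x m)
  have : IsNoetherianRing (ordLT k D x m) := Algebra.FiniteType.isNoetherianRing k _
  -- The elements of `I` of order less than `m` form an ideal of a Noetherian ring. Its finitely
  -- many generators are the proposed `D`-generators of `I`.
  obtain ⟨G, hG⟩ := (isNoetherianRing_iff_ideal_fg _).1 this (I.toIdeal.comap (ordLT k D x m).val)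
  let F : Finset S := G.image (ordLT k D x m).val
  have hFI : (F : Set S) ⊆ I.toIdeal := by
    intro s hs
    obtain ⟨a, ha, rfl⟩ := Finset.mem_image.1 (Finset.mem_coe.1 hs)
    have h1 : a ∈ I.toIdeal.comap (ordLT k D x m).val := by
      rw [← hG]
      exact Submodule.subset_span ha
    exact h1
  have hJI := DiffIdeal.span_le hFI
  have hm : ∀ f ∈ ordLT k D x m, f ∈ I.toIdeal → f ∈ (DiffIdeal.span D (F : Set S)).toIdeal := by
    intro f hf hfI
    have h1 : (⟨f, hf⟩ : ordLT k D x m) ∈ Ideal.span (G : Set (ordLT k D x m)) := by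
      rw [hG]
      exact hfI
    have h2 : Ideal.span (G : Set (ordLT k D x m)) ≤
        (DiffIdeal.span D (F : Set S)).toIdeal.comap (ordLT k D x m).val :=
      Submodule.span_le.2 fun a ha ↦
        DiffIdeal.subset_span _ (Finset.mem_coe.2 (Finset.mem_image_of_mem _ ha))
    exact h2 h1
  have hIJ : I.toIdeal = (DiffIdeal.span D (F : Set S)).toIdeal := by
    refine le_antisymm (fun f hf ↦ ?_) hJI
    obtain ⟨n, hn⟩ := exists_mem_ordLT x hx f
    exact h _ hJI hm n f hn hf
  refine ⟨F, ?_⟩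
  cases I
  cases hspan : DiffIdeal.span D (F : Set S)
  rw [hspan] at hIJ
  cases hIJ
  rfl

end FinitePresentation

/-! ### The finite presentation -/

theorem mainTheorem10 {k D B : Type*} [Field k] [CharZero k] [LieRing D] [Module k D]
    [Module.Finite k D] [LieRingModule D k] [LieRinehartRing k D]
    [CommRing B] [HopfAlgebra k B] [LieRingModule D B] [DiffHopfAlgebra k D B]
    (hB : DiffFinitelyGenerated k D B) :
    DiffFinitePresentation k D B := by
  classical
  obtain ⟨S, hS⟩ := hB
  obtain ⟨r, X, hX, hXS, hSX⟩ := exists_isComultiplicative (k := k) S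
  let ι := Fin r ⊕ Fin r
  let e : ι × ι ≃ Fin (Fintype.card (ι × ι)) := Fintype.equivFin _
  let A := DiffPoly k D (Fin (Fintype.card (ι × ι)))
  obtain ⟨π, ⟨hπ, hπT⟩, -⟩ := DiffPoly.existsUnique_lift (k := k) (D := D)
    fun i ↦ X (e.symm i).1 (e.symm i).2
  let T : Matrix ι ι A := fun i j ↦ DiffPoly.T k D (e (i, j))
  have hT : T.map π = X := by
    ext i j
    exact (hπT _).trans (by simp)
  choose i' j' hij using hXS
  -- Since the antipode maps entries of `X` to entries of `X`, its value on `X` lifts to a matrix of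
  -- indeterminates, which has order `0`. Thus `Y T - 1` is a relation of order `0`.
  let Y : Matrix ι ι A := fun i j ↦ T (i' i j) (j' i j)
  have hYT : Y.map π = X.map (HopfAlgebra.antipode k) := by
    ext i j
    rw [Matrix.map_apply, Matrix.map_apply, hij, ← hT]
    rfl
  have hY (i j : ι) : Y i j ∈ ordLT k D (fun q : ι × ι ↦ T q.1 q.2) 1 :=
    mem_ordLT (fun q : ι × ι ↦ T q.1 q.2) one_pos (i' i j, j' i j)
  have hAtop : Algebra.adjoin k {s : A | ∃ t : ι × ι, ∃ l : List D,
      s = l.foldr (fun x b ↦ ⁅x, b⁆) (T t.1 t.2)} = ⊤ :=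
    DiffPoly.adjoin_eq_top e e.surjective
  have hBtop := adjoin_foldr_eq_top hS (fun q : ι × ι ↦ X q.1 q.2) hSX
  have hsurj : Function.Surjective π := by
    intro s
    obtain ⟨n, hn⟩ := exists_mem_ordLT _ hBtop s
    rw [← hT] at hn
    have h := hπ.map_ordLT (fun q : ι × ι ↦ T q.1 q.2) n
    change s ∈ ordLT k D (fun q : ι × ι ↦ π (T q.1 q.2)) n at hn
    rw [← h] at hn
    obtain ⟨a, -, ha⟩ := hn
    exact ⟨a, ha⟩
  have hFG : hπ.ker.FG := by
    let b := Module.finBasis k D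
    have hYX (i j : ι) : Y.map π i j ∈ ordLT k D (fun q : ι × ι ↦ T.map π q.1 q.2) 1 := by
      rw [hYT, Matrix.map_apply, hij, hT]
      exact mem_ordLT (fun q : ι × ι ↦ X q.1 q.2) one_pos (i' i j, j' i j)
    obtain ⟨m, hm1, hm⟩ := exists_forall_mem_span_X_smul
      (symbolSubmodule k b (T.map π) (Y.map π)) (fun n p hp ↦ (mem_symbolSubmodule.1 hp).1)
      (fun n hn i p hp ↦ X_smul_mem_symbolSubmodule hYX hn i hp)
    -- Symbols are generated in degrees up to `m`, which corresponds to relations of order at most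
    -- `m`, that is, less than `m + 1`.
    refine DiffIdeal.fg_of_forall_ordLT _ hAtop _ (m + 1) fun J hJI hJ n ↦ ?_
    have hn (n : ℕ) : ∀ f ∈ ordLT k D (fun q : ι × ι ↦ T q.1 q.2) (m + n + 1), π f = 0 →
        f ∈ J.toIdeal := by
      induction n with
      | zero => exact hJ
      | succ n ih =>
        refine mem_of_mem_ordLT_succ (m := m + n) hπ b hY (by rwa [hT]) ?_ (by rw [hYT, hT])
          (by omega) (hm _ (by omega)) J (fun f hf ↦ hJI hf) ih
        intro i j
        rw [hT]
        exact ⟨_, _, hij i j⟩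
    exact fun f hf hfI ↦ hn n f (ordLT_mono _ (by omega) hf) hfI
  refine ⟨_, hπ.ker, hFG, Ideal.quotientKerAlgEquivOfSurjective hsurj, fun x s ↦ ?_⟩
  obtain ⟨f, rfl⟩ := Ideal.Quotient.mk_surjective s
  exact hπ x f
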